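/- Let $K$ be a field of characteristic $0$ and let $H$ be a finite-dimensional $K$-vector space with a nondegenerate symmetric bilinear pairing $(\ ,\ )$, a basis $\{\phi_\alpha\}$ and dual basis $\{\phi^\alpha\}$. Let $\mathbb H=H((z^{-1}))$ with the symplectic form $\Omega(f,g)=\operatorname{Res}_{z=0}(f(-z),g(z))$ (the coefficient of $z^{-1}$), with Darboux coordinates $p_{k,\alpha},q_k^\alpha$ defined by $f=\sum_{k\ge 0}p_{k,\alpha}\phi^\alpha(-z)^{-1-k}+\sum_{k\ge 0}q_k^\alpha\phi_\alpha z^k$, and write $\mathbf q=\sum_{k\ge0}\mathbf q_kz^k$ with $\mathbf q_k=q_k^\alpha\phi_\alpha$. Let $R$ be a commutative $K$-algebra (for instance $K=\mathbb R$ or $\mathbb C$ and $R=\mathbb C$). The Fock space consists of the formal functions $\Psi=\sum_{g\in\mathbb Z}\hbar^g\Psi_g(\mathbf q)$, where each $\Psi_g$ is a formal power series over $R$ in the variables $q_k^\alpha$ ($k\ge 0$). A quadratic function $h$ on $\mathbb H$ is quantized by writing it in Darboux coordinates, ordering each monomial with the $q$'s to the left of the $p$'s, and replacing $q_k^\alpha$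 by multiplication by $q_k^\alpha$ and $p_{k,\alpha}$ by $\hbar\,\partial/\partial q_k^\alpha$; the result is denoted $\widehat h$. For an infinitesimal symplectic transformation $A$ of $\mathbb H$ (that is, $\Omega(Af,g)+\Omega(f,Ag)=0$ for all $f,g$) put $h_A(f)=\tfrac12\Omega(Af,f)$ and $\widehat A=\hbar^{-1}\widehat{h_A}$, and define the quantization of $T=\exp(A)$ by $U_T=\exp(\widehat A)$. Let $A=\sum_{m<0}A_mz^m$ with $A_m\in\operatorname{End}(H)$ be an infinitesimal symplectic transformation, and let $$S(z)=\exp(A)=I+S_1/z+S_2/z^2+\cdots .$$ Then $S$ is invertible with $S^{-1}=\exp(-A)$; there are unique $W_{k\ell}\in\operatorname{End}(H)$ with $$\sum_{k,\ell\ge0}\frac{W_{k\ell}}{z^kw^\ell}=\frac{S^*(w)S(z)-I}{w^{-1}+z^{-1}},$$ where $*$ denotes the coefficientwise adjoint with respect to the pairing; and with $W_S(\mathbf q)=\sum_{k,\ell\ge0}(W_{k\ell}\mathbf q_k,\mathbf q_\ell)$, for every $\Psi$ in the Fock space, $$(U_{S^{-1}}\Psi)(\mathbf q)=\exp\left(\frac{W_S(\mathbf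 q)}{2\hbar}\right)\Psi([S\mathbf q]_+).$$ Here $[S\mathbf q]_+$ is the part of $S(z)\mathbf q$ with nonnegative powers of $z$. The series defining the two sides converge formally: for each power of $\hbar$ and each monomial in the $q_k^\alpha$, only finitely many terms contribute to its coefficient. -/

import Mathlib

open scoped Nat

noncomputable section

namespace GiventalQuantization

section LoopSpace

variable {K H : Type*} [Field K] [AddCommGroup H] [Module K H]

/-- The loop space `H((z⁻¹))`: formal Laurent series in the variable `z⁻¹` with coefficients in
`H`.  Thus `f.coeff n` is the coefficient of `z⁻ⁿ` in `f`. -/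
abbrev LoopSpace (H : Type*) [AddCommGroup H] : Type _ := HahnSeries ℤ H

/-- The coefficient of `z ^ k` in `f`. -/
def zCoeff (f : LoopSpace H) (k : ℤ) : H := f.coeff (-k)

/-- The element `v z ^ k` of the loop space. -/
def zMonomial (v : H) (k : ℤ) : LoopSpace H := HahnSeries.single (-k) v

/-- The symplectic form `Ω(f, g) = Res_{z = 0} (f(-z), g(z))`, that is, the coefficient of `z⁻¹`
in the Laurent series `(f(-z), g(z))`.  The sum has only finitely many non-zero terms. -/
def Omega (B : LinearMap.BilinForm K H) (f g : LoopSpace H) : K :=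
  ∑ᶠ i : ℤ, (-1 : K) ^ i * B (zCoeff f i) (zCoeff g (-1 - i))

/-- Coefficients of the product `T(z) f(z)`, for `T(z) = ∑ Tⱼ z⁻ʲ`: the coefficient of `z⁻ⁿ` is
`∑ⱼ Tⱼ f₋₍ₙ₋ⱼ₎`, which is a finite sum. -/
def actCoeff (T : PowerSeries (Module.End K H)) (f : LoopSpace H) (n : ℤ) : H :=
  ∑ᶠ j : ℕ, (PowerSeries.coeff j T) (f.coeff (n - j))

theorem actCoeff_bddBelow (T : PowerSeries (Module.End K H)) (f : LoopSpace H) :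
    BddBelow (Function.support (actCoeff T f)) := by
  refine ⟨f.order, fun n hn => ?_⟩
  by_contra hlt
  refine hn ?_
  rw [actCoeff]
  refine finsum_eq_zero_of_forall_eq_zero fun j => ?_
  have hj : (0 : ℤ) ≤ (j : ℤ) := Int.natCast_nonneg j
  rw [HahnSeries.coeff_eq_zero_of_lt_order (by omega), map_zero]

/-- The endomorphism `f ↦ T(z) f(z)` of the loop space given by `T(z) = ∑_{j ≥ 0} Tⱼ z⁻ʲ` with
`Tⱼ ∈ End(H)`.  Here a power series `T` over `End(H)` is read as a series in `z⁻¹`: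
`PowerSeries.coeff j T` is the coefficient of `z⁻ʲ`. -/
def act (T : PowerSeries (Module.End K H)) (f : LoopSpace H) : LoopSpace H :=
  HahnSeries.ofSuppBddBelow (actCoeff T f) (actCoeff_bddBelow T f)

/-- `A` is an infinitesimal symplectic transformation of `(H((z⁻¹)), Ω)`. -/
def IsInfinitesimalSymplectic (B : LinearMap.BilinForm K H)
    (A : PowerSeries (Module.End K H)) : Prop :=
  ∀ f g : LoopSpace H, Omega B (act A f) g + Omega B f (act A g) = 0

/-- The exponential `∑ₙ Aⁿ / n!` of a series `A(z) = A₁ z⁻¹ + A₂ z⁻² + ⋯` without constant term.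
The power `Aⁿ` is then divisible by `z⁻ⁿ`, so only the terms with `n ≤ k` contribute to the
coefficient of `z⁻ᵏ`. -/
def expSeries (A : PowerSeries (Module.End K H)) : PowerSeries (Module.End K H) :=
  PowerSeries.mk fun k =>
    ∑ n ∈ Finset.range (k + 1), ((n ! : K)⁻¹) • PowerSeries.coeff k (A ^ n)

/-- The quadratic Hamiltonian `h_A(f) = Ω(A f, f) / 2`. -/
def hamiltonian (B : LinearMap.BilinForm K H) (A : PowerSeries (Module.End K H))
    (f : LoopSpace H) : K :=
  (2 : K)⁻¹ * Omega B (act A f) f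

/-- The series `∑_{k,l ≥ 0} F k l z⁻ᵏ w⁻ˡ` in two commuting variables; the variable with index `0`
is `z⁻¹` and the one with index `1` is `w⁻¹`. -/
def doubleSeries (F : ℕ → ℕ → Module.End K H) : MvPowerSeries (Fin 2) (Module.End K H) :=
  fun d => F (d 0) (d 1)

/-- The adjoint of an endomorphism of `H` with respect to the pairing. -/
def adj (B : LinearMap.BilinForm K H) [FiniteDimensional K H] (hB : B.Nondegenerate)
    (M : Module.End K H) : Module.End K H :=
  LinearMap.BilinForm.leftAdjointOfNondegenerate B hB M

/-- The defining equation of the coefficients `W k l ∈ End(H)`: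
`∑_{k,l ≥ 0} W k l z⁻ᵏ w⁻ˡ = (S*(w) S(z) - I) / (w⁻¹ + z⁻¹)`. -/
def IsWCoeff (B : LinearMap.BilinForm K H) [FiniteDimensional K H] (hB : B.Nondegenerate)
    (S : PowerSeries (Module.End K H)) (W : ℕ → ℕ → Module.End K H) : Prop :=
  (MvPowerSeries.X 1 + MvPowerSeries.X 0) * doubleSeries W =
    doubleSeries (fun k l => adj B hB (PowerSeries.coeff l S) * PowerSeries.coeff k S) - 1

end LoopSpace

section FockSpace

/-- The Fock space: formal functions of `𝐪 = ∑ q_k^α φ_α z^k` with values in `R[[ħ, ħ⁻¹]]`.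
An element is a formal sum `Ψ = ∑_{g ∈ ℤ} ħ^g Ψ_g(𝐪)`, where each `Ψ g` is a formal power series
in the infinitely many variables `q_k^α`, indexed by `(k, α) ∈ ℕ × ι`. -/
abbrev Fock (ι R : Type*) : Type _ := ℤ → MvPowerSeries (ℕ × ι) R

variable {ι R : Type*} [CommRing R]

/-- A family of elements of the Fock space is summable if each coefficient (of a power of `ħ` times
a monomial in the `q_k^α`) is non-zero for finitely many members only. -/
def FockSummable {I : Type*} (F : I → Fock ι R) : Prop :=
  ∀ (g : ℤ) (d : ℕ × ι →₀ ℕ), {i | MvPowerSeries.coeff d (F i g) ≠ 0}.Finite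

/-- The coefficientwise sum of a family of formal power series. -/
def formalSum {I : Type*} (F : I → MvPowerSeries (ℕ × ι) R) : MvPowerSeries (ℕ × ι) R :=
  fun d => ∑ᶠ i, MvPowerSeries.coeff d (F i)

/-- The coefficientwise sum of a (summable) family in the Fock space. -/
def fockSum {I : Type*} (F : I → Fock ι R) : Fock ι R := fun g => formalSum fun i => F i g

/-- Multiplication by `ħ ^ n`. -/
def hbarPow (n : ℤ) (Ψ : Fock ι R) : Fock ι R := fun g => Ψ (g - n)

/-- The quantized coordinate function `q̂_k^α`: multiplication by `q_k^α`. -/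
def qHat (i : ℕ × ι) (Ψ : Fock ι R) : Fock ι R := fun g => MvPowerSeries.X i * Ψ g

/-- The quantized coordinate function `p̂_{k,α} = ħ ∂/∂q_k^α`. -/
def pHat (i : ℕ × ι) (Ψ : Fock ι R) : Fock ι R :=
  hbarPow 1 fun g => MvPowerSeries.pderiv R i (Ψ g)

/-- The terms `exp(T) Ψ = ∑ₙ Tⁿ Ψ / n!` of the exponential series of an operator. -/
def expTerm (K : Type*) [Field K] [Algebra K R] (T : Fock ι R → Fock ι R) (Ψ : Fock ι R) (n : ℕ) :
    Fock ι R :=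
  ((n ! : K)⁻¹) • T^[n] Ψ

/-- The terms of `exp(W / 2ħ) Ψ = ∑ₙ ħ⁻ⁿ Wⁿ Ψ / (2ⁿ n!)`, for a formal power series `W(𝐪)`. -/
def expMulTerm (K : Type*) [Field K] [Algebra K R] (W : MvPowerSeries (ℕ × ι) R) (Ψ : Fock ι R)
    (n : ℕ) : Fock ι R :=
  hbarPow (-n) fun g => ((2 ^ n * (n ! : K))⁻¹) • (W ^ n * Ψ g)

/-- The function `exp(W(𝐪) / 2ħ) Ψ(𝐪)`. -/
def expMul (K : Type*) [Field K] [Algebra K R] (W : MvPowerSeries (ℕ × ι) R) (Ψ : Fock ι R) :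
    Fock ι R :=
  fockSum (expMulTerm K W Ψ)

end FockSpace

section Quantization

variable {K H ι R : Type*} [Field K] [AddCommGroup H] [Module K H] [CommRing R] [Algebra K R]

/-- The vector `φ_α z^k`, dual to the Darboux coordinate `q_k^α`. -/
def qVec (b : Module.Basis ι K H) (i : ℕ × ι) : LoopSpace H := zMonomial (b i.2) (i.1 : ℤ)

/-- The vector `φ^α (-z)^(-1-k)`, dual to the Darboux coordinate `p_{k,α}`, where `φ^α` is the
basis of `H` dual to `φ_α` under the pairing. -/
def pVec [Finite ι] [DecidableEq ι] (B : LinearMap.BilinForm K H) (hB : B.Nondegenerate)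
    (b : Module.Basis ι K H) (i : ℕ × ι) : LoopSpace H :=
  zMonomial ((-1 : K) ^ (-1 - (i.1 : ℤ)) • B.dualBasis hB b i.2) (-1 - (i.1 : ℤ))

/-- The terms of the quantization of a quadratic observable `h`.  In Darboux coordinates
`h = ∑_{i,j} (½ a_{ij} q_i q_j + b_{ij} q_i p_j + ½ c_{ij} p_i p_j)`, where the second-order Taylor
coefficients `a, b, c` are the values of the polarization `h(x + y) - h(x) - h(y)` on the Darboux
basis; each monomial is quantized with the `q` variables to the left of the `p` variables. -/
def quadTerm [Finite ι] [DecidableEq ι] (B : LinearMap.BilinForm K H) (hB : B.Nondegenerate)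
    (b : Module.Basis ι K H) (h : LoopSpace H → K) (Ψ : Fock ι R)
    (ij : (ℕ × ι) × (ℕ × ι)) : Fock ι R :=
  ((2 : K)⁻¹ * QuadraticMap.polar h (qVec b ij.1) (qVec b ij.2)) • qHat ij.1 (qHat ij.2 Ψ)
    + QuadraticMap.polar h (qVec b ij.1) (pVec B hB b ij.2) • qHat ij.1 (pHat ij.2 Ψ)
    + ((2 : K)⁻¹ * QuadraticMap.polar h (pVec B hB b ij.1) (pVec B hB b ij.2)) •
        pHat ij.1 (pHat ij.2 Ψ)

/-- The quantization `ĥ` of a quadratic observable `h`. -/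
def quantizeQuadratic [Finite ι] [DecidableEq ι] (B : LinearMap.BilinForm K H)
    (hB : B.Nondegenerate) (b : Module.Basis ι K H) (h : LoopSpace H → K) (Ψ : Fock ι R) :
    Fock ι R :=
  fockSum (quadTerm B hB b h Ψ)

/-- The quantization `Â = ħ⁻¹ ĥ_A` of an infinitesimal symplectic transformation `A`. -/
def hatOp [Finite ι] [DecidableEq ι] (B : LinearMap.BilinForm K H) (hB : B.Nondegenerate)
    (b : Module.Basis ι K H) (A : PowerSeries (Module.End K H)) (Ψ : Fock ι R) : Fock ι R :=
  hbarPow (-1) (quantizeQuadratic B hB b (hamiltonian B A) Ψ)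

/-- The quantization `U_T = exp(Â)` of the symplectomorphism `T = exp(A)`. -/
def quantizedExp [Finite ι] [DecidableEq ι] (B : LinearMap.BilinForm K H) (hB : B.Nondegenerate)
    (b : Module.Basis ι K H) (A : PowerSeries (Module.End K H)) (Ψ : Fock ι R) : Fock ι R :=
  fockSum (expTerm K (hatOp B hB b A) Ψ)

/-- The coordinates of `[S 𝐪]₊`, as formal linear functions of the coordinates of `𝐪`: the
`(k, α)` coordinate is `∑_{(l, β)} s_{(l, β)} q_l^β`, where `s_{(l, β)}` is the `φ_α z^k` component
of `S(z) φ_β z^l`.  Only `k ≥ 0` occurs, which is the truncation `[ ]₊`. -/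
def truncAct (R : Type*) [CommRing R] [Algebra K R] (b : Module.Basis ι K H)
    (S : PowerSeries (Module.End K H)) (i : ℕ × ι) : MvPowerSeries (ℕ × ι) R :=
  formalSum fun j : ℕ × ι =>
    b.repr (zCoeff (act S (qVec b j)) (i.1 : ℤ)) i.2 • (MvPowerSeries.X j : MvPowerSeries (ℕ × ι) R)

/-- The formal function `Ψ([S 𝐪]₊)`. -/
def pullback (b : Module.Basis ι K H) (S : PowerSeries (Module.End K H)) (Ψ : Fock ι R) :
    Fock ι R :=
  fun g => MvPowerSeries.subst (truncAct R b S) (Ψ g)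

/-- The quadratic form `∑_{k,l} (W k l 𝐪_k, 𝐪_l)` with `𝐪_k = ∑_α q_k^α φ_α`, as a formal power
series in the coordinates `q_k^α`. -/
def quadForm (R : Type*) [CommRing R] [Algebra K R] (B : LinearMap.BilinForm K H)
    (b : Module.Basis ι K H) (W : ℕ → ℕ → Module.End K H) : MvPowerSeries (ℕ × ι) R :=
  formalSum fun ij : (ℕ × ι) × (ℕ × ι) =>
    B (W ij.1.1 ij.2.1 (b ij.1.2)) (b ij.2.2) •
      (MvPowerSeries.X ij.1 * MvPowerSeries.X ij.2 : MvPowerSeries (ℕ × ι) R)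

end Quantization

end GiventalQuantization

end

/-! Since `A` contains only negative powers of `z`, the Hamiltonian of `-A` has no `pp` terms, so
its quantization is a first-order operator `D + ħ⁻¹ Q` (`hatOp_apply`). Here `D` is the derivation
given by the linear vector field `𝐪 ↦ [A𝐪]₊`, and `Q` is half the quadratic form with kernel `a(z,w)
= (A(z) + A*(w)) / (z⁻¹ + w⁻¹)`. This quotient is a genuine series because the symplectic condition
says `A*(w) = -A(-w)`.

For such an operator, `exp(t(D + Q/ħ)) = exp(P(t)/ħ) exp(tD)` with `P(t) = ∫₀ᵗ exp(sD) Q ds`: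
differentiating in `t`, both sides solve the same equation. This is proved coefficient by
coefficient in `t` (`iterate_eq_sum_flowTerm`). It remains to identify the two factors at `t = 1`.

The operator `exp(D)` is an algebra endomorphism, hence a substitution. On coordinates it is `𝐪 ↦
[exp(A)𝐪]₊`, because truncation is compatible with products of series in `z⁻¹` (`actMatrix_mul`,
`evalOne_expFlow_eq_subst`).

On quadratic forms, `D` acts on kernels by `L F = A*(w) F + F A(z)` (`linearField_quadSeries`), so
`2P(1)` has kernel `∑ Lⁿ a / (n+1)!`. The central element `z⁻¹ + w⁻¹` commutes with `L` and sends
`a` to `L 1`. Multiplying the kernel by it therefore gives `exp(L) 1 - 1 = S*(w) S(z) - 1`, which is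
the defining equation of `W` (`isWCoeff_wCoeff`).

Convergence is controlled by giving `q_k^α` the weight `k + 1`. There are finitely many monomials
below any weight, `D` raises weight by at least one, and `Q` has positive weight. Hence the
coefficient of `tⁿ` vanishes in weights below `n`, and `t = 1` may be substituted. -/

noncomputable section

namespace GiventalQuantization

/-! ### The symplectic loop space -/

section Loop

variable {K H ι : Type*} [Field K] [AddCommGroup H] [Module K H]

theorem zCoeff_add (f g : LoopSpace H) (k : ℤ) : zCoeff (f + g) k = zCoeff f k + zCoeff g k := rfl

theorem zCoeff_neg (f : LoopSpace H) (k : ℤ) : zCoeff (-f) k = -zCoeff f k := rfl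

theorem zCoeff_zMonomial (v : H) (k n : ℤ) :
    zCoeff (zMonomial v k) n = if n = k then v else 0 := by
  rw [zCoeff, zMonomial, HahnSeries.coeff_single]
  simp only [neg_inj]

theorem coeff_act (T : PowerSeries (Module.End K H)) (f : LoopSpace H) (n : ℤ) :
    (act T f).coeff n = actCoeff T f n := rfl

theorem finite_support_actCoeff (T : PowerSeries (Module.End K H)) (f : LoopSpace H) (n : ℤ) :
    (Function.support fun j : ℕ => (PowerSeries.coeff j T) (f.coeff (n - j))).Finite := by
  refine (Set.finite_Iic (n - f.order).toNat).subset fun j hj => ?_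
  by_contra h
  refine hj ?_
  simp only [Set.mem_Iic, not_le] at h
  change (PowerSeries.coeff j T) (f.coeff (n - j)) = 0
  rw [HahnSeries.coeff_eq_zero_of_lt_order (by omega), map_zero]

theorem act_add (T : PowerSeries (Module.End K H)) (f g : LoopSpace H) :
    act T (f + g) = act T f + act T g := by
  ext n
  rw [HahnSeries.coeff_add, coeff_act, coeff_act, coeff_act, actCoeff, actCoeff, actCoeff,
    ← finsum_add_distrib (finite_support_actCoeff T f n) (finite_support_actCoeff T g n)]
  simp

theorem act_neg (T : PowerSeries (Module.End K H)) (f : LoopSpace H) :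
    act (-T) f = -act T f := by
  ext n
  rw [HahnSeries.coeff_neg, coeff_act, coeff_act, actCoeff, actCoeff, ← finsum_neg_distrib]
  simp

theorem zCoeff_act_zMonomial (T : PowerSeries (Module.End K H)) (v : H) (k n : ℤ) :
    zCoeff (act T (zMonomial v k)) n =
      if n ≤ k then PowerSeries.coeff (k - n).toNat T v else 0 := by
  rw [zCoeff, coeff_act, actCoeff, finsum_eq_single _ (k - n).toNat]
  · rw [zMonomial, HahnSeries.coeff_single]
    split_ifs with h1 h2 h2
    · rfl
    · omega
    · omega
    · rw [map_zero]
  · intro j hj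
    rw [zMonomial, HahnSeries.coeff_single, if_neg (by omega), map_zero]

theorem finite_support_Omega (B : LinearMap.BilinForm K H) (f g : LoopSpace H) :
    (Function.support fun i : ℤ =>
      (-1 : K) ^ i * B (zCoeff f i) (zCoeff g (-1 - i))).Finite := by
  refine (Set.finite_Icc (g.order - 1) (-f.order)).subset fun i hi => ?_
  by_contra h
  refine hi ?_
  simp only [Set.mem_Icc, not_and_or, not_le] at h
  change (-1 : K) ^ i * B (f.coeff (-i)) (g.coeff (-(-1 - i))) = 0
  rcases h with h | h
  · rw [HahnSeries.coeff_eq_zero_of_lt_order (x := g) (by omega), map_zero, mul_zero]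
  · rw [HahnSeries.coeff_eq_zero_of_lt_order (x := f) (by omega), map_zero, LinearMap.zero_apply,
      mul_zero]

theorem Omega_add_left (B : LinearMap.BilinForm K H) (f f' g : LoopSpace H) :
    Omega B (f + f') g = Omega B f g + Omega B f' g := by
  rw [Omega, Omega, Omega,
    ← finsum_add_distrib (finite_support_Omega B f g) (finite_support_Omega B f' g)]
  simp [zCoeff_add, mul_add]

theorem Omega_add_right (B : LinearMap.BilinForm K H) (f g g' : LoopSpace H) :
    Omega B f (g + g') = Omega B f g + Omega B f g' := by
  rw [Omega, Omega, Omega,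
    ← finsum_add_distrib (finite_support_Omega B f g) (finite_support_Omega B f g')]
  simp [zCoeff_add, mul_add]

theorem Omega_neg_left (B : LinearMap.BilinForm K H) (f g : LoopSpace H) :
    Omega B (-f) g = -Omega B f g := by
  rw [Omega, Omega, ← finsum_neg_distrib]
  simp [zCoeff_neg]

theorem Omega_neg_right (B : LinearMap.BilinForm K H) (f g : LoopSpace H) :
    Omega B f (-g) = -Omega B f g := by
  rw [Omega, Omega, ← finsum_neg_distrib]
  simp [zCoeff_neg]

/-- The reindexing `i ↦ -1 - i` exchanges the two factors and changes the parity of the exponent of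
`-1`. -/
theorem Omega_swap {B : LinearMap.BilinForm K H} (hsymm : B.IsSymm) (f g : LoopSpace H) :
    Omega B g f = -Omega B f g := by
  rw [Omega, Omega, ← finsum_neg_distrib, ← finsum_comp_equiv (Equiv.subLeft (-1 : ℤ))]
  refine finsum_congr fun i => ?_
  have h : (-1 : K) ^ (-1 - i) = -(-1 : K) ^ i := by
    rw [zpow_sub₀ (by simp), zpow_neg_one, inv_neg, inv_one, div_eq_mul_inv, ← zpow_neg,
      zpow_neg, ← inv_zpow, inv_neg, inv_one, neg_one_mul]
  rw [Equiv.subLeft_apply, h, sub_sub_cancel, hsymm.eq, neg_mul]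

theorem Omega_zMonomial_right (B : LinearMap.BilinForm K H) (f : LoopSpace H) (w : H) (l : ℤ) :
    Omega B f (zMonomial w l) = (-1 : K) ^ (-1 - l) * B (zCoeff f (-1 - l)) w := by
  rw [Omega, finsum_eq_single _ (-1 - l)]
  · rw [zCoeff_zMonomial, if_pos (by ring)]
  · intro i hi
    rw [zCoeff_zMonomial, if_neg (by omega), map_zero, mul_zero]

theorem IsInfinitesimalSymplectic.neg {B : LinearMap.BilinForm K H}
    {A : PowerSeries (Module.End K H)} (hA : IsInfinitesimalSymplectic B A) :
    IsInfinitesimalSymplectic B (-A) := by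
  intro f g
  rw [act_neg, act_neg, Omega_neg_left, Omega_neg_right, ← neg_add, hA f g, neg_zero]

/-- The polarization is the average of `Ω(Af, g)` and `Ω(Ag, f)`, which coincide by the symplectic
condition and the antisymmetry of `Ω`. -/
theorem IsInfinitesimalSymplectic.polar_hamiltonian [CharZero K] {B : LinearMap.BilinForm K H}
    (hsymm : B.IsSymm) {A : PowerSeries (Module.End K H)} (hA : IsInfinitesimalSymplectic B A)
    (f g : LoopSpace H) :
    QuadraticMap.polar (hamiltonian B A) f g = Omega B (act A f) g := by
  have h : Omega B (act A g) f = Omega B (act A f) g := by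
    rw [Omega_swap hsymm f, eq_neg_of_add_eq_zero_left (hA f g)]
  rw [QuadraticMap.polar, hamiltonian, hamiltonian, hamiltonian, act_add, Omega_add_left,
    Omega_add_right, Omega_add_right, h]
  ring

/-- This is the symplectic condition in the form `A*(z) = -A(-z)`. -/
theorem IsInfinitesimalSymplectic.apply_coeff {B : LinearMap.BilinForm K H}
    (hsymm : B.IsSymm) {A : PowerSeries (Module.End K H)} (hA : IsInfinitesimalSymplectic B A)
    (m : ℕ) (x y : H) :
    B (PowerSeries.coeff m A x) y = -((-1) ^ m * B x (PowerSeries.coeff m A y)) := by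
  -- The degrees `0` and `m - 1` add up to `-1` exactly after lowering by `m`, so the residue
  -- isolates the coefficient `A_m`.
  have h := hA (zMonomial x 0) (zMonomial y (m - 1))
  rw [Omega_swap hsymm (act A _) (zMonomial x 0), Omega_zMonomial_right, Omega_zMonomial_right,
    zCoeff_act_zMonomial, zCoeff_act_zMonomial, if_pos (by omega), if_pos (by omega)] at h
  have e1 : ((0 : ℤ) - (-1 - (m - 1))).toNat = m := by omega
  have e2 : (((m : ℤ) - 1) - (-1 - 0)).toNat = m := by omega
  have e3 : (-1 : K) ^ (-1 - ((m : ℤ) - 1)) = (-1) ^ m := by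
    rw [show (-1 - ((m : ℤ) - 1)) = -(m : ℤ) by ring, zpow_neg, zpow_natCast, ← inv_pow, inv_neg,
      inv_one]
  rw [e1, e2, e3] at h
  norm_num at h
  have hs : (-1 : K) ^ m * (-1) ^ m = 1 := by rw [← mul_pow]; simp
  rw [hsymm.eq _ x] at h
  have := congrArg (fun t => (-1 : K) ^ m * t) h
  simp only [mul_add, ← mul_assoc, hs, mul_zero, one_mul] at this
  linear_combination this

end Loop

/-! ### Coefficientwise sums and derivations in infinitely many variables -/

section FormalSums

variable {σ R I J : Type*} [CommRing R]

/-- Each coefficient is non-zero for finitely many members of the family only. -/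
def CoeffFinite (F : I → MvPowerSeries σ R) : Prop :=
  ∀ d, {i | MvPowerSeries.coeff d (F i) ≠ 0}.Finite

/-- The coefficientwise sum, for variables with an arbitrary index type. -/
def coeffSum (F : I → MvPowerSeries σ R) : MvPowerSeries σ R :=
  fun d => ∑ᶠ i, MvPowerSeries.coeff d (F i)

theorem coeff_coeffSum (F : I → MvPowerSeries σ R) (d : σ →₀ ℕ) :
    MvPowerSeries.coeff d (coeffSum F) = ∑ᶠ i, MvPowerSeries.coeff d (F i) := rfl

theorem coeff_algebra_smul {K : Type*} [Field K] [Algebra K R] (c : K) (f : MvPowerSeries σ R)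
    (d : σ →₀ ℕ) : MvPowerSeries.coeff d (c • f) = c • MvPowerSeries.coeff d f := rfl

theorem exists_coeff_ne_zero_of_coeffSum {F : I → MvPowerSeries σ R} {d : σ →₀ ℕ}
    (h : MvPowerSeries.coeff d (coeffSum F) ≠ 0) : ∃ i, MvPowerSeries.coeff d (F i) ≠ 0 := by
  by_contra! h'
  exact h (finsum_eq_zero_of_forall_eq_zero h')

theorem CoeffFinite.add {F G : I → MvPowerSeries σ R} (hF : CoeffFinite F) (hG : CoeffFinite G) :
    CoeffFinite fun i => F i + G i := by
  intro d
  refine ((hF d).union (hG d)).subset fun i hi => ?_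
  by_contra h
  simp only [Set.mem_union, Set.mem_ofPred_eq, not_or, not_not] at h
  exact hi (by rw [map_add, h.1, h.2, add_zero])

theorem CoeffFinite.smul {K : Type*} [Field K] [Algebra K R] {F : I → MvPowerSeries σ R}
    (hF : CoeffFinite F) (c : I → K) : CoeffFinite fun i => c i • F i := by
  intro d
  refine (hF d).subset fun i hi h => hi ?_
  change MvPowerSeries.coeff d (c i • F i) = 0
  rw [coeff_algebra_smul, h, smul_zero]

theorem CoeffFinite.mul {F : I → MvPowerSeries σ R} (hF : CoeffFinite F)
    (g : I → MvPowerSeries σ R) : CoeffFinite fun i => F i * g i := by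
  classical
  intro d
  refine ((Finset.HasAntidiagonal.antidiagonal d).finite_toSet.biUnion
    fun p _ => hF p.1).subset fun i hi => ?_
  by_contra h
  simp only [Finset.mem_coe, Set.mem_iUnion, Set.mem_ofPred_eq, not_exists, not_not] at h
  refine hi ?_
  rw [MvPowerSeries.coeff_mul]
  exact Finset.sum_eq_zero fun p hp => by rw [h p hp, zero_mul]

theorem coeffSum_add {F G : I → MvPowerSeries σ R} (hF : CoeffFinite F) (hG : CoeffFinite G) :
    (coeffSum fun i => F i + G i) = coeffSum F + coeffSum G := by
  ext d
  simp only [coeff_coeffSum, map_add]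
  exact finsum_add_distrib (hF d) (hG d)

theorem coeffSum_smul {K : Type*} [Field K] [Algebra K R] {F : I → MvPowerSeries σ R}
    (hF : CoeffFinite F) (c : K) : (coeffSum fun i => c • F i) = c • coeffSum F := by
  ext d
  simp only [coeff_coeffSum, coeff_algebra_smul]
  exact (smul_finsum' c (hF d)).symm

theorem coeffSum_curry {F : I × J → MvPowerSeries σ R} (hF : CoeffFinite F) :
    coeffSum F = coeffSum fun i => coeffSum fun j => F (i, j) := by
  ext d
  simp only [coeff_coeffSum]
  exact finsum_curry _ (hF d)

theorem CoeffFinite.swap {F : I × J → MvPowerSeries σ R} (hF : CoeffFinite F) :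
    CoeffFinite fun p : J × I => F p.swap := fun d =>
  (hF d).preimage Prod.swap_injective.injOn

theorem coeffSum_swap (F : I × J → MvPowerSeries σ R) :
    (coeffSum fun p : J × I => F p.swap) = coeffSum F := by
  ext d
  exact finsum_comp_equiv (Equiv.prodComm J I) (f := fun p => MvPowerSeries.coeff d (F p))

theorem coeffSum_curry_swap {F : I × J → MvPowerSeries σ R} (hF : CoeffFinite F) :
    coeffSum F = coeffSum fun j => coeffSum fun i => F (i, j) := by
  rw [← coeffSum_swap, coeffSum_curry hF.swap]
  rfl

/-- Each coefficient of the image under `T` depends on finitely many coefficients only. -/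
def IsCoeffLocal (T : MvPowerSeries σ R →+ MvPowerSeries σ R) : Prop :=
  ∀ d, ∃ s : Finset (σ →₀ ℕ), ∀ f, (∀ e ∈ s, MvPowerSeries.coeff e f = 0) →
    MvPowerSeries.coeff d (T f) = 0

/-- A given output coefficient sees finitely many input coefficients, and those see finitely many
members of the family. The claim thus reduces to additivity over a finite partial sum. -/
theorem IsCoeffLocal.map_coeffSum {T : MvPowerSeries σ R →+ MvPowerSeries σ R}
    (hT : IsCoeffLocal T) {F : I → MvPowerSeries σ R} (hF : CoeffFinite F) :
    T (coeffSum F) = coeffSum fun i => T (F i) := by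
  classical
  ext d
  obtain ⟨s, hs⟩ := hT d
  have hfin := s.finite_toSet.biUnion fun e _ => hF e
  set t := hfin.toFinset with ht
  have hmem : ∀ i, i ∉ t → ∀ e ∈ s, MvPowerSeries.coeff e (F i) = 0 := by
    intro i hi e he
    by_contra h
    exact hi (by
      rw [ht, Set.Finite.mem_toFinset]
      exact Set.mem_biUnion (Finset.mem_coe.2 he) h)
  have h0 : MvPowerSeries.coeff d (T (coeffSum F - ∑ i ∈ t, F i)) = 0 := by
    refine hs _ fun e he => ?_
    rw [map_sub, map_sum, coeff_coeffSum, finsum_eq_sum_of_support_subset, sub_self]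
    intro i hi
    by_contra h
    exact hi (hmem i h e he)
  rw [map_sub, map_sub, sub_eq_zero, map_sum, map_sum] at h0
  rw [h0, coeff_coeffSum, finsum_eq_sum_of_support_subset]
  intro i hi
  by_contra h
  exact hi (hs _ (hmem i h))

theorem isCoeffLocal_mulLeft (g : MvPowerSeries σ R) : IsCoeffLocal (AddMonoidHom.mulLeft g) := by
  classical
  intro d
  refine ⟨(Finset.HasAntidiagonal.antidiagonal d).image Prod.snd, fun f hf => ?_⟩
  rw [AddMonoidHom.coe_mulLeft, MvPowerSeries.coeff_mul]
  exact Finset.sum_eq_zero fun p hp => by rw [hf _ (Finset.mem_image_of_mem _ hp), mul_zero]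

theorem mul_coeffSum {F : I → MvPowerSeries σ R} (hF : CoeffFinite F) (g : MvPowerSeries σ R) :
    g * coeffSum F = coeffSum fun i => g * F i :=
  (isCoeffLocal_mulLeft g).map_coeffSum hF

theorem coeffSum_mul {F : I → MvPowerSeries σ R} (hF : CoeffFinite F) (g : MvPowerSeries σ R) :
    coeffSum F * g = coeffSum fun i => F i * g := by
  simp only [mul_comm _ g, mul_coeffSum hF]

/-- The derivation `∑ⱼ ξⱼ ∂/∂qⱼ`. -/
def vectorField (ξ : σ → MvPowerSeries σ R) (hξ : CoeffFinite ξ) :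
    Derivation R (MvPowerSeries σ R) (MvPowerSeries σ R) :=
  Derivation.mk'
    { toFun := fun f => coeffSum fun j => ξ j * MvPowerSeries.pderiv R j f
      map_add' := fun f g => by
        simp only [map_add, mul_add]
        exact coeffSum_add (hξ.mul _) (hξ.mul _)
      map_smul' := fun r f => by
        simp only [Derivation.map_smul, RingHom.id_apply]
        rw [MvPowerSeries.smul_eq_C_mul, mul_coeffSum (hξ.mul _)]
        simp only [MvPowerSeries.smul_eq_C_mul, mul_left_comm] }
    (by
      intro f g
      simp only [LinearMap.coe_mk, AddHom.coe_mk, Derivation.leibniz, smul_eq_mul, mul_add]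
      rw [mul_coeffSum (hξ.mul _), mul_coeffSum (hξ.mul _),
        ← coeffSum_add
          (by simpa only [mul_left_comm] using hξ.mul fun i => f * MvPowerSeries.pderiv R i g)
          (by simpa only [mul_left_comm] using hξ.mul fun i => g * MvPowerSeries.pderiv R i f)]
      simp only [mul_left_comm])

theorem vectorField_apply (ξ : σ → MvPowerSeries σ R) (hξ : CoeffFinite ξ)
    (f : MvPowerSeries σ R) :
    vectorField ξ hξ f = coeffSum fun j => ξ j * MvPowerSeries.pderiv R j f := rfl

theorem vectorField_X (ξ : σ → MvPowerSeries σ R) (hξ : CoeffFinite ξ) (j : σ) :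
    vectorField ξ hξ (MvPowerSeries.X j) = ξ j := by
  ext d
  rw [vectorField_apply, coeff_coeffSum, finsum_eq_single _ j, MvPowerSeries.pderiv_X_self, mul_one]
  intro i hi
  rw [MvPowerSeries.pderiv_X_of_ne hi.symm, mul_zero, map_zero]

/-- Only finitely many `ξ j` have a nonzero coefficient at a divisor of the monomial `d`, and each
of them involves finitely many coefficients of `∂f/∂qⱼ`. -/
theorem isCoeffLocal_vectorField (ξ : σ → MvPowerSeries σ R) (hξ : CoeffFinite ξ) :
    IsCoeffLocal (vectorField ξ hξ : MvPowerSeries σ R →+ MvPowerSeries σ R) := by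
  classical
  intro d
  have hfin := (Finset.HasAntidiagonal.antidiagonal d).finite_toSet.biUnion fun p _ => hξ p.1
  refine ⟨(hfin.toFinset ×ˢ Finset.HasAntidiagonal.antidiagonal d).image
    fun x => x.2.2 + Finsupp.single x.1 1, fun f hf => ?_⟩
  change MvPowerSeries.coeff d (vectorField ξ hξ f) = 0
  rw [vectorField_apply, coeff_coeffSum]
  refine finsum_eq_zero_of_forall_eq_zero fun j => ?_
  rw [MvPowerSeries.coeff_mul]
  refine Finset.sum_eq_zero fun p hp => ?_
  by_cases h : MvPowerSeries.coeff p.1 (ξ j) = 0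
  · rw [h, zero_mul]
  · rw [MvPowerSeries.coeff_pderiv, hf, zero_mul, mul_zero]
    refine Finset.mem_image.2 ⟨(j, p), Finset.mem_product.2 ⟨?_, hp⟩, rfl⟩
    rw [Set.Finite.mem_toFinset]
    exact Set.mem_biUnion (Finset.mem_coe.2 hp) h

theorem vectorField_coeffSum {ξ : σ → MvPowerSeries σ R} (hξ : CoeffFinite ξ)
    {F : I → MvPowerSeries σ R} (hF : CoeffFinite F) :
    vectorField ξ hξ (coeffSum F) = coeffSum fun i => vectorField ξ hξ (F i) :=
  (isCoeffLocal_vectorField ξ hξ).map_coeffSum hF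

/-! ### Linear vector fields acting on linear and quadratic forms -/

section LinearQuadratic

variable {K : Type*} [Field K] [Algebra K R]

variable (R) in
/-- The linear form `∑ⱼ cⱼ qⱼ`. -/
def linSeries (c : σ → K) : MvPowerSeries σ R :=
  coeffSum fun j => c j • (MvPowerSeries.X j : MvPowerSeries σ R)

variable (R) in
/-- The quadratic form `∑ᵢⱼ cᵢⱼ qᵢ qⱼ`. -/
def quadSeries (c : σ × σ → K) : MvPowerSeries σ R :=
  coeffSum fun p => c p • (MvPowerSeries.X p.1 * MvPowerSeries.X p.2 : MvPowerSeries σ R)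

theorem coeffFinite_X : CoeffFinite (MvPowerSeries.X : σ → MvPowerSeries σ R) := by
  classical
  intro d
  refine d.support.finite_toSet.subset fun j hj => ?_
  have h : d = Finsupp.single j 1 := by
    by_contra h
    exact hj (by rw [MvPowerSeries.coeff_X, if_neg h])
  simp [h]

theorem CoeffFinite.of_fst {F : I → MvPowerSeries σ R} (hF : CoeffFinite F) {G : I × J →
    MvPowerSeries σ R} (h : ∀ d i j, MvPowerSeries.coeff d (G (i, j)) ≠ 0 →
      ∃ e ≤ d, MvPowerSeries.coeff e (F i) ≠ 0)
    (hG : ∀ i, {j | G (i, j) ≠ 0}.Finite) : CoeffFinite G := by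
  classical
  intro d
  have h1 := (Finset.finite_toSet (Finset.Iic d)).biUnion fun e _ => hF e
  refine (h1.biUnion fun i _ => (hG i).image (Prod.mk i)).subset ?_
  rintro ⟨i, j⟩ hij
  obtain ⟨e, he, he'⟩ := h d i j hij
  refine Set.mem_biUnion (Set.mem_biUnion (Finset.mem_coe.2 (Finset.mem_Iic.2 he)) he') ?_
  refine ⟨j, fun h0 => hij ?_, rfl⟩
  rw [h0, map_zero]

theorem exists_coeff_X_ne_zero_of_mul {i : σ} {f : MvPowerSeries σ R} {d : σ →₀ ℕ}
    (h : MvPowerSeries.coeff d (MvPowerSeries.X i * f) ≠ 0) :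
    ∃ e ≤ d, MvPowerSeries.coeff e (MvPowerSeries.X i : MvPowerSeries σ R) ≠ 0 := by
  classical
  rw [MvPowerSeries.coeff_mul] at h
  obtain ⟨p, hp, hp'⟩ := Finset.exists_ne_zero_of_sum_ne_zero h
  refine ⟨p.1, le_self_add.trans_eq (Finset.HasAntidiagonal.mem_antidiagonal.1 hp),
    left_ne_zero_of_mul hp'⟩

theorem coeffFinite_X_mul_X :
    CoeffFinite (fun p : σ × σ => (MvPowerSeries.X p.1 * MvPowerSeries.X p.2 :
      MvPowerSeries σ R)) := by
  classical
  intro d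
  refine (d.support ×ˢ d.support).finite_toSet.subset fun p hp => ?_
  have h : d = Finsupp.single p.1 1 + Finsupp.single p.2 1 := by
    by_contra h
    refine hp ?_
    change MvPowerSeries.coeff d (MvPowerSeries.X p.1 * MvPowerSeries.X p.2) = 0
    rw [MvPowerSeries.X_def, MvPowerSeries.X_def, MvPowerSeries.monomial_mul_monomial,
      MvPowerSeries.coeff_monomial, if_neg h]
  simp [h]

theorem coeffFinite_smul_X_mul {μ : σ → J → K} (hμ : ∀ m, {j | μ m j ≠ 0}.Finite)
    (f : σ → J → MvPowerSeries σ R) :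
    CoeffFinite fun p : σ × J =>
      μ p.1 p.2 • ((MvPowerSeries.X p.1 : MvPowerSeries σ R) * f p.1 p.2) := by
  refine (coeffFinite_X (R := R)).of_fst (fun d i j h => ?_)
    (fun i => (hμ i).subset fun j hj h => hj ?_)
  · rw [← mul_smul_comm] at h
    exact exists_coeff_X_ne_zero_of_mul h
  · change μ i j • _ = _
    rw [h, zero_smul]

theorem smul_coeffSum_finite {c : I → K} (hc : {i | c i ≠ 0}.Finite) (f : MvPowerSeries σ R) :
    (coeffSum fun i => c i • f) = (∑ᶠ i, c i) • f := by
  ext d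
  simp only [coeff_coeffSum, coeff_algebra_smul]
  exact (finsum_smul' hc _).symm

/-- Finite columns mean that each variable `q_m` occurs in finitely many of the linear forms. The
rows may be infinite. -/
theorem coeffFinite_linSeries {μ : σ → σ → K} (hμ : ∀ m, {j | μ j m ≠ 0}.Finite) :
    CoeffFinite fun j => linSeries R (μ j) := by
  classical
  intro d
  have h := (coeffFinite_smul_X_mul (R := R) (μ := fun m j => μ j m) hμ fun _ _ => 1) d
  refine (h.image Prod.snd).subset fun j hj => ?_
  obtain ⟨m, hm⟩ := exists_coeff_ne_zero_of_coeffSum hj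
  exact ⟨(m, j), by simpa using hm, rfl⟩

variable {μ : σ → σ → K} (hμ : ∀ m, {j | μ j m ≠ 0}.Finite)

theorem vectorField_map_smul {ξ : σ → MvPowerSeries σ R} (hξ : CoeffFinite ξ) (c : K)
    (f : MvPowerSeries σ R) : vectorField ξ hξ (c • f) = c • vectorField ξ hξ f := by
  rw [← algebraMap_smul R c f, Derivation.map_smul, algebraMap_smul]

theorem coeffSum_smul_linSeries_mul (hμ : ∀ m, {j | μ j m ≠ 0}.Finite) (c : σ → K)
    (f : MvPowerSeries σ R) :
    (coeffSum fun j => c j • (linSeries R (μ j) * f)) =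
      coeffSum fun m => (∑ᶠ j, c j * μ j m) • ((MvPowerSeries.X m : MvPowerSeries σ R) * f) := by
  have hμ' : ∀ m, {j | c j * μ j m ≠ 0}.Finite := fun m =>
    (hμ m).subset fun j hj => right_ne_zero_of_mul hj
  have hF := coeffFinite_smul_X_mul (R := R) hμ' fun _ _ => f
  have h1 : ∀ j, c j • (linSeries R (μ j) * f) = coeffSum fun m =>
      (c j * μ j m) • ((MvPowerSeries.X m : MvPowerSeries σ R) * f) := by
    intro j
    rw [linSeries, coeffSum_mul (coeffFinite_X.smul _),
      ← coeffSum_smul ((coeffFinite_X.smul _).mul _)]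
    simp only [mul_smul, smul_mul_assoc]
  simp only [h1]
  -- The double family over `(m, j)` is summable, so it can be summed in either order.
  have h2 := (coeffSum_curry_swap hF).symm.trans (coeffSum_curry hF)
  simp only at h2
  rw [h2]
  simp only [smul_coeffSum_finite (hμ' _)]

theorem vectorField_linSeries (c : σ → K) :
    vectorField _ (coeffFinite_linSeries (R := R) hμ) (linSeries R c) =
      linSeries R fun m => ∑ᶠ j, c j * μ j m := by
  rw [linSeries, vectorField_coeffSum _ (coeffFinite_X.smul _)]
  simp only [vectorField_map_smul, vectorField_X]
  simpa only [mul_one, linSeries] using coeffSum_smul_linSeries_mul (R := R) hμ c 1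

theorem coeffFinite_linSeries_mul_X (hμ : ∀ m, {j | μ j m ≠ 0}.Finite) (c : σ × σ → K) :
    CoeffFinite fun p : σ × σ =>
      c p • (linSeries R (μ p.1) * (MvPowerSeries.X p.2 : MvPowerSeries σ R)) := by
  classical
  intro d
  have h1 := (Finset.finite_toSet (Finset.Iic d)).biUnion fun e _ =>
    coeffFinite_linSeries (R := R) hμ e
  have h2 := (Finset.finite_toSet (Finset.Iic d)).biUnion fun e _ => coeffFinite_X (R := R) e
  refine (h1.prod h2).subset fun p hp => ?_
  have h : MvPowerSeries.coeff d (linSeries R (μ p.1) * (MvPowerSeries.X p.2 :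
      MvPowerSeries σ R)) ≠ 0 := by
    intro h
    exact hp (by rw [coeff_algebra_smul, h, smul_zero])
  rw [MvPowerSeries.coeff_mul] at h
  obtain ⟨q, hq, hq'⟩ := Finset.exists_ne_zero_of_sum_ne_zero h
  exact ⟨Set.mem_biUnion (Finset.mem_coe.2 (Finset.mem_Iic.2
      (le_self_add.trans_eq (Finset.HasAntidiagonal.mem_antidiagonal.1 hq))))
      (left_ne_zero_of_mul hq'),
    Set.mem_biUnion (Finset.mem_coe.2 (Finset.mem_Iic.2
      (le_add_self.trans_eq (Finset.HasAntidiagonal.mem_antidiagonal.1 hq))))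
      (right_ne_zero_of_mul hq')⟩

theorem coeffSum_linSeries_mul_X (hμ : ∀ m, {j | μ j m ≠ 0}.Finite) (c : σ × σ → K) :
    (coeffSum fun p : σ × σ =>
        c p • (linSeries R (μ p.1) * (MvPowerSeries.X p.2 : MvPowerSeries σ R))) =
      quadSeries R fun p => ∑ᶠ i, c (i, p.2) * μ i p.1 := by
  have hF := coeffFinite_linSeries_mul_X (R := R) hμ c
  have hG := (coeffFinite_X_mul_X (R := R) (σ := σ)).smul fun p => ∑ᶠ i, c (i, p.2) * μ i p.1
  rw [coeffSum_curry_swap hF, quadSeries, coeffSum_curry_swap hG]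
  congr 1
  ext j : 1
  exact coeffSum_smul_linSeries_mul hμ (fun i => c (i, j)) (MvPowerSeries.X j : MvPowerSeries σ R)

theorem quadSeries_swap (c : σ × σ → K) : (quadSeries R fun p => c p.swap) = quadSeries R c := by
  rw [quadSeries, quadSeries, ← coeffSum_swap]
  simp only [Prod.swap_swap, Prod.fst_swap, Prod.snd_swap, mul_comm]

theorem quadSeries_add (c c' : σ × σ → K) :
    quadSeries R (fun p => c p + c' p) = quadSeries R c + quadSeries R c' := by
  rw [quadSeries, quadSeries, quadSeries,
    ← coeffSum_add (coeffFinite_X_mul_X.smul _) (coeffFinite_X_mul_X.smul _)]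
  simp only [add_smul]

/-- The Leibniz rule produces one term for each factor of `qᵢ qⱼ`. Transposing the indices turns the
second term into the first. -/
theorem vectorField_quadSeries (c : σ × σ → K) :
    vectorField _ (coeffFinite_linSeries (R := R) hμ) (quadSeries R c) =
      quadSeries R fun p => ∑ᶠ i, c (i, p.2) * μ i p.1 + ∑ᶠ i, c (p.1, i) * μ i p.2 := by
  have e : ∀ p : σ × σ, vectorField _ (coeffFinite_linSeries (R := R) hμ)
      (c p • (MvPowerSeries.X p.1 * MvPowerSeries.X p.2)) =
      c p • (linSeries R (μ p.1) * MvPowerSeries.X p.2) +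
        c p • (linSeries R (μ p.2) * MvPowerSeries.X p.1) := by
    intro p
    rw [vectorField_map_smul, Derivation.leibniz, vectorField_X, vectorField_X, smul_eq_mul,
      smul_eq_mul, mul_comm, mul_comm (MvPowerSeries.X p.2), ← smul_add, add_comm]
  have hs := (coeffFinite_linSeries_mul_X (R := R) hμ fun p : σ × σ => c p.swap).swap
  simp only [Prod.swap_swap, Prod.fst_swap, Prod.snd_swap] at hs
  have hsw := coeffSum_swap fun p : σ × σ => c p.swap •
    (linSeries R (μ p.1) * (MvPowerSeries.X p.2 : MvPowerSeries σ R))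
  simp only [Prod.swap_swap, Prod.fst_swap, Prod.snd_swap] at hsw
  rw [quadSeries_add, quadSeries, vectorField_coeffSum _ (coeffFinite_X_mul_X.smul _)]
  simp only [e]
  rw [coeffSum_add (coeffFinite_linSeries_mul_X hμ c) hs, coeffSum_linSeries_mul_X hμ, hsw,
    coeffSum_linSeries_mul_X hμ, ← quadSeries_swap fun p : σ × σ => ∑ᶠ i, c (p.1, i) * μ i p.2]
  rfl

end LinearQuadratic

end FormalSums

/-! ### The weight filtration and evaluation at `t = 1` -/

section Weight

variable {σ R : Type*} [CommRing R] {wt : σ → ℕ}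

variable (wt) in
/-- The coefficients of all monomials of weight less than `n` vanish. -/
def VanishBelow (n : ℕ) (f : MvPowerSeries σ R) : Prop :=
  ∀ d, Finsupp.weight wt d < n → MvPowerSeries.coeff d f = 0

theorem VanishBelow.zero_fun (n : ℕ) : VanishBelow wt n (0 : MvPowerSeries σ R) := fun _ _ =>
  map_zero _

theorem vanishBelow_zero (f : MvPowerSeries σ R) : VanishBelow wt 0 f := fun _ h =>
  absurd h (Nat.not_lt_zero _)

theorem VanishBelow.mono {m n : ℕ} (hmn : m ≤ n) {f : MvPowerSeries σ R}
    (hf : VanishBelow wt n f) : VanishBelow wt m f := fun d hd => hf d (hd.trans_le hmn)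

theorem VanishBelow.smul {K : Type*} [Field K] [Algebra K R] {n : ℕ} {f : MvPowerSeries σ R}
    (hf : VanishBelow wt n f) (c : K) : VanishBelow wt n (c • f) :=
  fun d hd => by rw [coeff_algebra_smul, hf d hd, smul_zero]

theorem VanishBelow.sum {I : Type*} {n : ℕ} {s : Finset I} {F : I → MvPowerSeries σ R}
    (hF : ∀ i ∈ s, VanishBelow wt n (F i)) : VanishBelow wt n (∑ i ∈ s, F i) :=
  fun d hd => by rw [map_sum]; exact Finset.sum_eq_zero fun i hi => hF i hi d hd

theorem VanishBelow.coeffSum {I : Type*} {n : ℕ} {F : I → MvPowerSeries σ R}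
    (hF : ∀ i, VanishBelow wt n (F i)) : VanishBelow wt n (coeffSum F) :=
  fun d hd => finsum_eq_zero_of_forall_eq_zero fun i => hF i d hd

theorem VanishBelow.mul {m n : ℕ} {f g : MvPowerSeries σ R}
    (hf : VanishBelow wt m f) (hg : VanishBelow wt n g) : VanishBelow wt (m + n) (f * g) := by
  classical
  intro d hd
  rw [MvPowerSeries.coeff_mul]
  refine Finset.sum_eq_zero fun p hp => ?_
  rw [← Finset.HasAntidiagonal.mem_antidiagonal.1 hp, map_add] at hd
  by_cases h : Finsupp.weight wt p.1 < m
  · rw [hf _ h, zero_mul]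
  · rw [hg _ (by omega), mul_zero]

theorem VanishBelow.pow {m : ℕ} {f : MvPowerSeries σ R} (hf : VanishBelow wt m f) (n : ℕ) :
    VanishBelow wt (n * m) (f ^ n) := by
  induction n with
  | zero => rw [zero_mul]; exact vanishBelow_zero _
  | succ n ih => rw [pow_succ, add_mul, one_mul]; exact ih.mul hf

theorem vanishBelow_X (i : σ) : VanishBelow wt (wt i) (MvPowerSeries.X i : MvPowerSeries σ R) := by
  classical
  intro d hd
  rw [MvPowerSeries.coeff_X, if_neg]
  rintro rfl
  rw [Finsupp.weight_single, one_smul] at hd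
  exact hd.false

theorem VanishBelow.pderiv {n : ℕ} {f : MvPowerSeries σ R} (hf : VanishBelow wt n f) (i : σ) :
    VanishBelow wt (n - wt i) (MvPowerSeries.pderiv R i f) := by
  intro d hd
  rw [MvPowerSeries.coeff_pderiv, hf, zero_mul]
  rw [map_add, Finsupp.weight_single, one_smul]
  omega

variable (wt) in
/-- The coefficient of `tⁿ` vanishes in weights less than `n`, so that one can set `t = 1`. -/
def Rapid (F : PowerSeries (MvPowerSeries σ R)) : Prop :=
  ∀ n, VanishBelow wt n (PowerSeries.coeff n F)

variable (wt) in
/-- The value at `t = 1` of a series in `t`. -/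
def evalOne (F : PowerSeries (MvPowerSeries σ R)) : MvPowerSeries σ R := fun d =>
  ∑ n ∈ Finset.range (Finsupp.weight wt d + 1), MvPowerSeries.coeff d (PowerSeries.coeff n F)

theorem coeff_evalOne_def (F : PowerSeries (MvPowerSeries σ R)) (d : σ →₀ ℕ) :
    MvPowerSeries.coeff d (evalOne wt F) = ∑ n ∈ Finset.range (Finsupp.weight wt d + 1),
      MvPowerSeries.coeff d (PowerSeries.coeff n F) := rfl

/-- The cutoff may be enlarged at will, so that coefficients at different monomials can be computed
with a common one. -/
theorem Rapid.coeff_evalOne {F : PowerSeries (MvPowerSeries σ R)} (hF : Rapid wt F)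
    {d : σ →₀ ℕ} {N : ℕ} (hN : Finsupp.weight wt d < N) :
    MvPowerSeries.coeff d (evalOne wt F) =
      ∑ n ∈ Finset.range N, MvPowerSeries.coeff d (PowerSeries.coeff n F) := by
  refine Finset.sum_subset (Finset.range_subset_range.2 hN) fun n _ hn => hF n d ?_
  simpa using hn

theorem Rapid.mul {F G : PowerSeries (MvPowerSeries σ R)} (hF : Rapid wt F) (hG : Rapid wt G) :
    Rapid wt (F * G) := by
  intro n
  rw [PowerSeries.coeff_mul]
  refine VanishBelow.sum fun p hp => ?_
  rw [← Finset.HasAntidiagonal.mem_antidiagonal.1 hp]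
  exact (hF _).mul (hG _)

theorem rapid_one : Rapid wt (1 : PowerSeries (MvPowerSeries σ R)) := by
  intro n
  rw [PowerSeries.coeff_one]
  split_ifs with h
  · rw [h]; exact vanishBelow_zero _
  · exact VanishBelow.zero_fun n

theorem Rapid.pow {F : PowerSeries (MvPowerSeries σ R)} (hF : Rapid wt F) (m : ℕ) :
    Rapid wt (F ^ m) := by
  induction m with
  | zero => rw [pow_zero]; exact rapid_one
  | succ m ih => rw [pow_succ]; exact ih.mul hF

theorem Rapid.smul {K : Type*} [Field K] [Algebra K R] {F : PowerSeries (MvPowerSeries σ R)}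
    (hF : Rapid wt F) (c : K) : Rapid wt (c • F) := fun n => (hF n).smul c

theorem evalOne_smul {K : Type*} [Field K] [Algebra K R] (F : PowerSeries (MvPowerSeries σ R))
    (c : K) : evalOne wt (c • F) = c • evalOne wt F := by
  ext d
  simp only [coeff_algebra_smul, coeff_evalOne_def, Finset.smul_sum]
  rfl

theorem evalOne_add (F G : PowerSeries (MvPowerSeries σ R)) :
    evalOne wt (F + G) = evalOne wt F + evalOne wt G := by
  ext d
  simp only [map_add, coeff_evalOne_def, Finset.sum_add_distrib]

theorem evalOne_one : evalOne wt (1 : PowerSeries (MvPowerSeries σ R)) = 1 := by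
  ext d
  rw [rapid_one.coeff_evalOne (Nat.lt_succ_self _), Finset.sum_range_succ', Finset.sum_eq_zero]
  · simp
  · intro n _
    rw [PowerSeries.coeff_one, if_neg (Nat.succ_ne_zero n), map_zero]

/-- Completes a triangle of indices to a square, which turns Cauchy products of truncated sums into
products of sums. -/
theorem sum_range_antidiagonal {M : Type*} [AddCommMonoid M] {N : ℕ} (f : ℕ → ℕ → M)
    (hf : ∀ i j, N ≤ i + j → f i j = 0) :
    ∑ n ∈ Finset.range N, ∑ p ∈ Finset.HasAntidiagonal.antidiagonal n, f p.1 p.2 =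
      ∑ i ∈ Finset.range N, ∑ j ∈ Finset.range N, f i j := by
  rw [← Finset.sum_product', Finset.sum_sigma']
  refine Finset.sum_bij_ne_zero (fun x _ _ => x.2) ?_ ?_ ?_ ?_
  · rintro ⟨n, i, j⟩ h _
    simp only [Finset.mem_sigma, Finset.mem_range, Finset.HasAntidiagonal.mem_antidiagonal] at h
    simp only [Finset.mem_product, Finset.mem_range]
    omega
  · rintro ⟨n, i, j⟩ h _ ⟨n', i', j'⟩ h' _ e
    simp only [Finset.mem_sigma, Finset.mem_range, Finset.HasAntidiagonal.mem_antidiagonal] at h h'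
    simp only [Prod.mk.injEq] at e
    obtain ⟨rfl, rfl⟩ := e
    obtain rfl : n = n' := by omega
    rfl
  · rintro ⟨i, j⟩ _ h
    refine ⟨⟨i + j, i, j⟩, ?_, h, rfl⟩
    simp only [Finset.mem_sigma, Finset.mem_range, Finset.HasAntidiagonal.mem_antidiagonal,
      and_true]
    by_contra hN
    exact h (hf i j (by omega))
  · intros
    rfl

theorem evalOne_mul {F G : PowerSeries (MvPowerSeries σ R)} (hF : Rapid wt F)
    (hG : Rapid wt G) : evalOne wt (F * G) = evalOne wt F * evalOne wt G := by
  classical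
  ext d
  set N := Finsupp.weight wt d + 1 with hN
  have hlt : ∀ p ∈ Finset.HasAntidiagonal.antidiagonal d,
      Finsupp.weight wt p.1 < N ∧ Finsupp.weight wt p.2 < N := by
    intro p hp
    rw [hN, ← Finset.HasAntidiagonal.mem_antidiagonal.1 hp, map_add]
    omega
  rw [(hF.mul hG).coeff_evalOne (N := N) (by omega), MvPowerSeries.coeff_mul]
  simp only [PowerSeries.coeff_mul, map_sum]
  rw [sum_range_antidiagonal (fun i j => MvPowerSeries.coeff d
    (PowerSeries.coeff i F * PowerSeries.coeff j G))
    fun i j hij => ((hF i).mul (hG j)) d (by omega)]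
  simp only [MvPowerSeries.coeff_mul]
  simp only [Finset.sum_comm (t := Finset.HasAntidiagonal.antidiagonal d)]
  refine Finset.sum_congr rfl fun p hp => ?_
  rw [hF.coeff_evalOne (hlt p hp).1, hG.coeff_evalOne (hlt p hp).2, Finset.sum_mul_sum]

theorem evalOne_pow {F : PowerSeries (MvPowerSeries σ R)} (hF : Rapid wt F) (m : ℕ) :
    evalOne wt (F ^ m) = evalOne wt F ^ m := by
  induction m with
  | zero => rw [pow_zero, pow_zero, evalOne_one]
  | succ m ih => rw [pow_succ, pow_succ, evalOne_mul (hF.pow m) hF, ih]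

end Weight

/-! ### Flow equations in a formal time `t` -/

section Flow

set_option linter.unusedSectionVars false

variable {𝒜 : Type*} [CommRing 𝒜]

/-- The coefficientwise action of a derivation on series in `t`. -/
def mapDeriv {R : Type*} [CommRing R] [Algebra R 𝒜] (D : Derivation R 𝒜 𝒜) (F : PowerSeries 𝒜) :
    PowerSeries 𝒜 :=
  PowerSeries.mk fun n => D (PowerSeries.coeff n F)

variable {R : Type*} [CommRing R] [Algebra R 𝒜] (D : Derivation R 𝒜 𝒜)

theorem coeff_mapDeriv (F : PowerSeries 𝒜) (n : ℕ) :
    PowerSeries.coeff n (mapDeriv D F) = D (PowerSeries.coeff n F) := PowerSeries.coeff_mk _ _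

theorem mapDeriv_mul (F G : PowerSeries 𝒜) :
    mapDeriv D (F * G) = F * mapDeriv D G + G * mapDeriv D F := by
  ext n
  rw [coeff_mapDeriv, mul_comm G, map_add, PowerSeries.coeff_mul, PowerSeries.coeff_mul,
    PowerSeries.coeff_mul, map_sum, ← Finset.sum_add_distrib]
  refine Finset.sum_congr rfl fun p _ => ?_
  rw [Derivation.leibniz, coeff_mapDeriv, coeff_mapDeriv, smul_eq_mul, smul_eq_mul,
    mul_comm (D (PowerSeries.coeff p.1 F))]

theorem mapDeriv_pow_succ (F : PowerSeries 𝒜) (m : ℕ) :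
    mapDeriv D (F ^ (m + 1)) = (m + 1 : ℕ) • (F ^ m * mapDeriv D F) := by
  induction m with
  | zero => simp
  | succ m ih =>
    rw [pow_succ, mapDeriv_mul, ih]
    simp only [nsmul_eq_mul]
    push_cast
    ring

variable (K : Type*) [Field K] [CharZero K] [Algebra K 𝒜]

/-- The series `exp(t D) f`. -/
def expFlow (f : 𝒜) : PowerSeries 𝒜 := PowerSeries.mk fun n => ((n ! : K)⁻¹) • D^[n] f

/-- The series `∫₀ᵗ exp(s D) Q ds`. -/
def flowIntegral (Q : 𝒜) : PowerSeries 𝒜 :=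
  PowerSeries.mk fun n => if n = 0 then 0 else ((n ! : K)⁻¹) • D^[n - 1] Q

theorem coeff_derivative_smul (F : PowerSeries 𝒜) (n : ℕ) :
    PowerSeries.coeff n (PowerSeries.derivative 𝒜 F) =
      (n + 1 : K) • PowerSeries.coeff (n + 1) F := by
  rw [PowerSeries.coeff_derivative, Algebra.smul_def, mul_comm]
  simp

theorem factorial_succ_smul (n : ℕ) (f : 𝒜) :
    (n + 1 : K) • (((n + 1)! : K)⁻¹ • f) = ((n ! : K)⁻¹) • f := by
  rw [smul_smul, Nat.factorial_succ]
  congr 1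
  push_cast
  have : (n + 1 : K) ≠ 0 := by exact_mod_cast n.succ_ne_zero
  field_simp

variable {K}

theorem Derivation.map_algebra_smul [Algebra K R] [IsScalarTower K R 𝒜] (c : K) (f : 𝒜) :
    D (c • f) = c • D f := by
  rw [← algebraMap_smul R c f, Derivation.map_smul, algebraMap_smul]

theorem smul_right_cancel_succ {n : ℕ} {f g : 𝒜} (h : (n + 1 : K) • f = (n + 1 : K) • g) :
    f = g := by
  have : (n + 1 : K) ≠ 0 := by exact_mod_cast n.succ_ne_zero
  simpa [smul_smul, this] using congrArg (fun x => (n + 1 : K)⁻¹ • x) h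

variable [Algebra K R] [IsScalarTower K R 𝒜]

theorem derivative_expFlow (f : 𝒜) :
    PowerSeries.derivative 𝒜 (expFlow D K f) = mapDeriv D (expFlow D K f) := by
  ext n
  rw [coeff_derivative_smul K, coeff_mapDeriv, expFlow, PowerSeries.coeff_mk, PowerSeries.coeff_mk,
    factorial_succ_smul, Derivation.map_algebra_smul, Function.iterate_succ_apply']

theorem derivative_flowIntegral (Q : 𝒜) :
    PowerSeries.derivative 𝒜 (flowIntegral D K Q) =
      mapDeriv D (flowIntegral D K Q) + PowerSeries.C Q := by
  ext n
  rw [coeff_derivative_smul K, map_add, coeff_mapDeriv, flowIntegral, PowerSeries.coeff_mk,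
    PowerSeries.coeff_mk, if_neg n.succ_ne_zero, factorial_succ_smul, PowerSeries.coeff_C]
  cases n with
  | zero => simp
  | succ n =>
    rw [if_neg n.succ_ne_zero, if_neg n.succ_ne_zero, add_zero, Derivation.map_algebra_smul,
      Nat.add_sub_cancel, Nat.add_sub_cancel, Function.iterate_succ_apply']

/-- Comparing coefficients gives `(n + 1) F_{n+1} = D F_n`. In characteristic zero this recursion
determines the series from its initial value. -/
theorem eq_of_derivative_eq_mapDeriv {F G : PowerSeries 𝒜}
    (h0 : PowerSeries.coeff 0 F = PowerSeries.coeff 0 G)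
    (hF : PowerSeries.derivative 𝒜 F = mapDeriv D F)
    (hG : PowerSeries.derivative 𝒜 G = mapDeriv D G) (K : Type*) [Field K] [CharZero K]
    [Algebra K 𝒜] : F = G := by
  ext n
  induction n with
  | zero => exact h0
  | succ n ih =>
    refine smul_right_cancel_succ (K := K) (n := n) ?_
    rw [← coeff_derivative_smul K, ← coeff_derivative_smul K, hF, hG, coeff_mapDeriv,
      coeff_mapDeriv, ih]

theorem coeff_zero_expFlow (f : 𝒜) : PowerSeries.coeff 0 (expFlow D K f) = f := by
  simp [expFlow]

/-- By the Leibniz rule both sides solve `F' = D F` with initial value `f g`. -/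
theorem expFlow_mul (f g : 𝒜) : expFlow D K (f * g) = expFlow D K f * expFlow D K g := by
  refine eq_of_derivative_eq_mapDeriv D ?_ (derivative_expFlow D _) ?_ K
  · rw [coeff_zero_expFlow, PowerSeries.coeff_zero_eq_constantCoeff_apply, map_mul,
      ← PowerSeries.coeff_zero_eq_constantCoeff_apply, coeff_zero_expFlow,
      ← PowerSeries.coeff_zero_eq_constantCoeff_apply, coeff_zero_expFlow]
  · rw [Derivation.leibniz, derivative_expFlow, derivative_expFlow, mapDeriv_mul, smul_eq_mul,
      smul_eq_mul]

theorem iterate_derivation_add (n : ℕ) (f g : 𝒜) : D^[n] (f + g) = D^[n] f + D^[n] g := by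
  induction n with
  | zero => rfl
  | succ n ih => simp only [Function.iterate_succ_apply', ih, map_add]

theorem expFlow_add (f g : 𝒜) : expFlow D K (f + g) = expFlow D K f + expFlow D K g := by
  ext n
  rw [map_add, expFlow, expFlow, expFlow, PowerSeries.coeff_mk, PowerSeries.coeff_mk,
    PowerSeries.coeff_mk, iterate_derivation_add, smul_add]

theorem expFlow_algebraMap (r : R) :
    expFlow D K (algebraMap R 𝒜 r) = PowerSeries.C (algebraMap R 𝒜 r) := by
  refine eq_of_derivative_eq_mapDeriv D ?_ (derivative_expFlow D _) ?_ K
  · rw [coeff_zero_expFlow, PowerSeries.coeff_zero_C]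
  · ext n
    rw [PowerSeries.derivative_C, coeff_mapDeriv, PowerSeries.coeff_C]
    split_ifs <;> simp

/-- The coefficient of `ħ⁻ᵐ` in the solution `exp(P(t)/ħ) exp(t D) f` of the flow equation, where
`P(t) = ∫₀ᵗ exp(s D) Q ds`. -/
def flowTerm (K : Type*) [Field K] [Algebra K 𝒜] (Q : 𝒜) (m : ℕ) (f : 𝒜) : PowerSeries 𝒜 :=
  ((m ! : K)⁻¹) • (flowIntegral D K Q ^ m * expFlow D K f)

theorem mapDeriv_smul (c : K) (F : PowerSeries 𝒜) : mapDeriv D (c • F) = c • mapDeriv D F := by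
  ext n
  exact Derivation.map_algebra_smul D c _

theorem derivative_smul_series (c : K) (F : PowerSeries 𝒜) :
    PowerSeries.derivative 𝒜 (c • F) = c • PowerSeries.derivative 𝒜 F :=
  Derivation.map_algebra_smul (R := 𝒜) (𝒜 := PowerSeries 𝒜) _ c F

theorem derivative_flowTerm_zero (Q f : 𝒜) :
    PowerSeries.derivative 𝒜 (flowTerm D K Q 0 f) = mapDeriv D (flowTerm D K Q 0 f) := by
  rw [flowTerm, pow_zero, one_mul, derivative_smul_series, mapDeriv_smul, derivative_expFlow]

/-- Since `P' = D P + Q`, the derivative of `P^(m+1) / (m+1)!` has the source term `Q P^m / m!`;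
everything else is accounted for by `D`. -/
theorem derivative_flowTerm_succ (Q f : 𝒜) (m : ℕ) :
    PowerSeries.derivative 𝒜 (flowTerm D K Q (m + 1) f) =
      mapDeriv D (flowTerm D K Q (m + 1) f) + PowerSeries.C Q * flowTerm D K Q m f := by
  have h : flowTerm D K Q m f =
      (m + 1 : K) • (((m + 1)! : K)⁻¹ • (flowIntegral D K Q ^ m * expFlow D K f)) := by
    rw [factorial_succ_smul, flowTerm]
  rw [h, flowTerm, derivative_smul_series, mapDeriv_smul, smul_comm, mul_smul_comm, ← smul_add]
  congr 1
  rw [mapDeriv_mul, mapDeriv_pow_succ, Derivation.leibniz, Derivation.leibniz_pow,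
    derivative_expFlow, derivative_flowIntegral, Nat.add_sub_cancel]
  rw [Algebra.smul_def (m + 1 : K)]
  simp only [nsmul_eq_mul, smul_eq_mul, map_add, map_natCast, map_one]
  push_cast
  ring

/-- The integral starts at `t = 0`, so its `m`-th power is divisible by `t^m`. -/
theorem coeff_flowTerm_of_lt (Q f : 𝒜) {n m : ℕ} (h : n < m) :
    PowerSeries.coeff n (flowTerm D K Q m f) = 0 := by
  have h0 : PowerSeries.X ∣ flowIntegral D K Q := by
    rw [PowerSeries.X_dvd_iff, ← PowerSeries.coeff_zero_eq_constantCoeff_apply, flowIntegral,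
      PowerSeries.coeff_mk, if_pos rfl]
  have h1 : PowerSeries.X ^ m ∣ flowIntegral D K Q ^ m * expFlow D K f :=
    (pow_dvd_pow_of_dvd h0 m).mul_right _
  rw [PowerSeries.X_pow_dvd_iff] at h1
  change ((m ! : K)⁻¹) • PowerSeries.coeff n (flowIntegral D K Q ^ m * expFlow D K f) = 0
  rw [h1 n h, smul_zero]

/-- The flow of the first order operator `Ψ ↦ D Ψ + ħ⁻¹ Q Ψ`. -/
theorem iterate_eq_sum_flowTerm (Q : 𝒜) (T : (ℤ → 𝒜) → ℤ → 𝒜)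
    (hT : ∀ Ψ g, T Ψ g = D (Ψ g) + Q * Ψ (g + 1)) (Ψ : ℤ → 𝒜) (n : ℕ) (g : ℤ) :
    ((n ! : K)⁻¹) • T^[n] Ψ g =
      ∑ m ∈ Finset.range (n + 1), PowerSeries.coeff n (flowTerm D K Q m (Ψ (g + m))) := by
  induction n generalizing g with
  | zero => simp [flowTerm, expFlow]
  | succ n ih =>
    refine smul_right_cancel_succ (K := K) (n := n) ?_
    rw [factorial_succ_smul, Function.iterate_succ_apply', hT, smul_add,
      ← Derivation.map_algebra_smul, ← mul_smul_comm, ih, ih, Finset.smul_sum,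
      Finset.sum_range_succ' _ (n + 1)]
    simp only [← coeff_derivative_smul K, derivative_flowTerm_succ, derivative_flowTerm_zero,
      map_add, coeff_mapDeriv, PowerSeries.coeff_C_mul]
    -- The term `m = 0` carries no source and is put back into the `D` sum. In that sum the new top
    -- index `n + 1` contributes nothing, since its term is divisible by `t^(n+1)`.
    rw [Finset.sum_add_distrib, add_right_comm,
      ← Finset.sum_range_succ' (fun m => D (PowerSeries.coeff n (flowTerm D K Q m (Ψ (g + m))))),
      Finset.sum_range_succ _ (n + 1), coeff_flowTerm_of_lt D Q _ n.lt_succ_self, map_zero,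
      add_zero, map_sum, Finset.mul_sum]
    congr 1
    refine Finset.sum_congr rfl fun m _ => ?_
    rw [Nat.cast_succ, add_assoc, add_comm (1 : ℤ)]

end Flow

/-! ### Exponentials of weight-raising operators -/

section FlowEvaluation

variable {σ R : Type*} [CommRing R] {wt : σ → ℕ}

/-- Differentiation removes a factor of weight `wt j`, and multiplication by `ξ j` restores at least
`wt j + 1`. -/
theorem vanishBelow_vectorField {ξ : σ → MvPowerSeries σ R} (hξ : CoeffFinite ξ)
    (h : ∀ j, VanishBelow wt (wt j + 1) (ξ j)) {n : ℕ} {f : MvPowerSeries σ R}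
    (hf : VanishBelow wt n f) : VanishBelow wt (n + 1) (vectorField ξ hξ f) := by
  rw [vectorField_apply]
  exact VanishBelow.coeffSum fun j => ((h j).mul (hf.pderiv j)).mono (by omega)

variable {D : Derivation R (MvPowerSeries σ R) (MvPowerSeries σ R)}

theorem vanishBelow_iterate
    (hD : ∀ n f, VanishBelow wt n f → VanishBelow wt (n + 1) (D f)) {n : ℕ}
    {f : MvPowerSeries σ R} (hf : VanishBelow wt n f) (k : ℕ) :
    VanishBelow wt (n + k) (D^[k] f) := by
  induction k with
  | zero => exact hf
  | succ k ih => rw [Function.iterate_succ_apply']; exact hD _ _ ih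

theorem VanishBelow.evalOne {n : ℕ} {F : PowerSeries (MvPowerSeries σ R)}
    (hF : ∀ k, VanishBelow wt n (PowerSeries.coeff k F)) : VanishBelow wt n (evalOne wt F) :=
  fun d hd => by
    rw [coeff_evalOne_def]; exact Finset.sum_eq_zero fun k _ => hF k d hd

variable {K : Type*} [Field K] [Algebra K R]

theorem rapid_expFlow (hD : ∀ n f, VanishBelow wt n f → VanishBelow wt (n + 1) (D f))
    (f : MvPowerSeries σ R) : Rapid wt (expFlow D K f) := by
  intro n
  rw [expFlow, PowerSeries.coeff_mk]
  exact ((vanishBelow_iterate hD (vanishBelow_zero f) n).mono (by omega)).smul _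

theorem rapid_flowIntegral (hD : ∀ n f, VanishBelow wt n f → VanishBelow wt (n + 1) (D f))
    {Q : MvPowerSeries σ R} (hQ : VanishBelow wt 1 Q) : Rapid wt (flowIntegral D K Q) := by
  intro n
  rw [flowIntegral, PowerSeries.coeff_mk]
  split_ifs with h
  · exact VanishBelow.zero_fun n
  -- Only `n - 1` derivations occur in the coefficient of `tⁿ`; the missing unit of weight comes
  -- from `Q`.
  · exact ((vanishBelow_iterate hD hQ (n - 1)).mono (by omega)).smul _

theorem vanishBelow_evalOne_expFlow
    (hD : ∀ n f, VanishBelow wt n f → VanishBelow wt (n + 1) (D f)) {n : ℕ}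
    {f : MvPowerSeries σ R} (hf : VanishBelow wt n f) :
    VanishBelow wt n (evalOne wt (expFlow D K f)) := by
  refine VanishBelow.evalOne fun k => ?_
  rw [expFlow, PowerSeries.coeff_mk]
  exact ((vanishBelow_iterate hD hf k).mono (by omega)).smul _

theorem evalOne_C (f : MvPowerSeries σ R) : evalOne wt (PowerSeries.C f) = f := by
  ext d
  rw [coeff_evalOne_def, Finset.sum_range_succ', Finset.sum_eq_zero]
  · simp
  · intro n _
    rw [PowerSeries.coeff_C, if_neg n.succ_ne_zero, map_zero]

theorem rapid_flowTerm (hD : ∀ n f, VanishBelow wt n f → VanishBelow wt (n + 1) (D f))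
    {Q : MvPowerSeries σ R} (hQ : VanishBelow wt 1 Q) (m : ℕ) (f : MvPowerSeries σ R) :
    Rapid wt (flowTerm D K Q m f) :=
  (((rapid_flowIntegral hD hQ).pow m).mul (rapid_expFlow hD f)).smul _

theorem evalOne_flowTerm (hD : ∀ n f, VanishBelow wt n f → VanishBelow wt (n + 1) (D f))
    {Q : MvPowerSeries σ R} (hQ : VanishBelow wt 1 Q) (m : ℕ) (f : MvPowerSeries σ R) :
    evalOne wt (flowTerm D K Q m f) =
      ((m ! : K)⁻¹) • (evalOne wt (flowIntegral D K Q) ^ m * evalOne wt (expFlow D K f)) := by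
  rw [flowTerm, evalOne_smul,
    evalOne_mul ((rapid_flowIntegral hD hQ).pow m) (rapid_expFlow hD f),
    evalOne_pow (rapid_flowIntegral hD hQ)]

variable [CharZero K]

variable (K) in
/-- The algebra endomorphism `exp(D)`. -/
def expDeriv (hD : ∀ n f, VanishBelow wt n f → VanishBelow wt (n + 1) (D f)) :
    MvPowerSeries σ R →ₐ[R] MvPowerSeries σ R where
  toFun f := evalOne wt (expFlow D K f)
  map_one' := by
    have h := expFlow_algebraMap (K := K) D 1
    rw [map_one] at h
    rw [h, evalOne_C]
  map_mul' f g := by rw [expFlow_mul, evalOne_mul (rapid_expFlow hD f) (rapid_expFlow hD g)]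
  map_zero' := by
    have h := expFlow_algebraMap (K := K) D 0
    rw [map_zero] at h
    rw [h, evalOne_C]
  map_add' f g := by rw [expFlow_add, evalOne_add]
  commutes' r := by rw [expFlow_algebraMap, evalOne_C]

theorem vanishBelow_finsupp_prod {a : σ → MvPowerSeries σ R}
    (ha : ∀ i, VanishBelow wt (wt i) (a i)) (e : σ →₀ ℕ) :
    VanishBelow wt (Finsupp.weight wt e) (e.prod fun i n => a i ^ n) := by
  classical
  rw [Finsupp.weight_apply, Finsupp.prod, Finsupp.sum]
  induction e.support using Finset.induction with
  | empty => rw [Finset.sum_empty]; exact vanishBelow_zero _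
  | insert i s hi ih =>
    rw [Finset.sum_insert hi, Finset.prod_insert hi]
    exact ((ha i).pow (e i)).mul ih

theorem vanishBelow_subst {a : σ → MvPowerSeries σ R} (hs : MvPowerSeries.HasSubst a)
    (ha : ∀ i, VanishBelow wt (wt i) (a i)) {n : ℕ} {f : MvPowerSeries σ R}
    (hf : VanishBelow wt n f) : VanishBelow wt n (MvPowerSeries.subst a f) := by
  intro d hd
  rw [MvPowerSeries.coeff_subst hs]
  refine finsum_eq_zero_of_forall_eq_zero fun e => ?_
  by_cases h : Finsupp.weight wt e < n
  · rw [hf e h, zero_smul]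
  · rw [vanishBelow_finsupp_prod ha e d (by omega), smul_zero]

theorem exists_mvPolynomial_sub_vanishBelow
    (hfin : ∀ N, {d : σ →₀ ℕ | Finsupp.weight wt d < N}.Finite) (f : MvPowerSeries σ R) (N : ℕ) :
    ∃ p : MvPolynomial σ R, VanishBelow wt N (f - (p : MvPowerSeries σ R)) := by
  classical
  refine ⟨∑ e ∈ (hfin N).toFinset, MvPolynomial.monomial e (MvPowerSeries.coeff e f),
    fun d hd => ?_⟩
  rw [map_sub, MvPolynomial.coeff_coe, MvPolynomial.coeff_sum, Finset.sum_eq_single d]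
  · rw [MvPolynomial.coeff_monomial, if_pos rfl, sub_self]
  · intro e _ he
    rw [MvPolynomial.coeff_monomial, if_neg he]
  · intro h
    exact absurd ((hfin N).mem_toFinset.2 hd) h

/-- Modulo high weight every series is a polynomial, and maps preserving the weight filtration are
determined by their values on polynomials. -/
theorem algHom_eq_of_X (hfin : ∀ N, {d : σ →₀ ℕ | Finsupp.weight wt d < N}.Finite)
    {S₁ S₂ : MvPowerSeries σ R →ₐ[R] MvPowerSeries σ R}
    (hS₁ : ∀ n f, VanishBelow wt n f → VanishBelow wt n (S₁ f))
    (hS₂ : ∀ n f, VanishBelow wt n f → VanishBelow wt n (S₂ f))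
    (h : ∀ i, S₁ (MvPowerSeries.X i) = S₂ (MvPowerSeries.X i)) : S₁ = S₂ := by
  have hp : S₁.comp (MvPolynomial.coeToMvPowerSeries.algHom R) =
      S₂.comp (MvPolynomial.coeToMvPowerSeries.algHom R) :=
    MvPolynomial.algHom_ext fun i => by simpa using h i
  ext f d
  obtain ⟨p, hp'⟩ := exists_mvPolynomial_sub_vanishBelow hfin f (Finsupp.weight wt d + 1)
  have h1 := hS₁ _ _ hp' d (Nat.lt_succ_self _)
  have h2 := hS₂ _ _ hp' d (Nat.lt_succ_self _)
  have h3 : S₁ (p : MvPowerSeries σ R) = S₂ p := by simpa using DFunLike.congr_fun hp p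
  rw [map_sub, map_sub, sub_eq_zero] at h1 h2
  rw [h1, h2, h3]

/-- `exp(D)` is the substitution of its values on the variables. -/
theorem evalOne_expFlow_eq_subst (hfin : ∀ N, {d : σ →₀ ℕ | Finsupp.weight wt d < N}.Finite)
    (hD : ∀ n f, VanishBelow wt n f → VanishBelow wt (n + 1) (D f))
    {a : σ → MvPowerSeries σ R} (hs : MvPowerSeries.HasSubst a)
    (ha : ∀ i, evalOne wt (expFlow D K (MvPowerSeries.X i)) = a i) (f : MvPowerSeries σ R) :
    evalOne wt (expFlow D K f) = MvPowerSeries.subst a f := by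
  have ha' : ∀ i, VanishBelow wt (wt i) (a i) := fun i =>
    ha i ▸ vanishBelow_evalOne_expFlow hD (vanishBelow_X i)
  have h : expDeriv K hD = MvPowerSeries.substAlgHom (R := R) hs := by
    refine algHom_eq_of_X hfin (fun n f hf => vanishBelow_evalOne_expFlow hD hf)
      (fun n f hf => ?_) fun i => ?_
    · rw [MvPowerSeries.substAlgHom_apply]
      exact vanishBelow_subst hs ha' hf
    · rw [MvPowerSeries.substAlgHom_X]
      exact ha i
  rw [← MvPowerSeries.substAlgHom_apply (R := R) hs, ← h]
  rfl

variable {Q : MvPowerSeries σ R} {T : (ℤ → MvPowerSeries σ R) → ℤ → MvPowerSeries σ R}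

theorem vanishBelow_iterate_operator
    (hD : ∀ n f, VanishBelow wt n f → VanishBelow wt (n + 1) (D f)) (hQ : VanishBelow wt 1 Q)
    (hT : ∀ Ψ g, T Ψ g = D (Ψ g) + Q * Ψ (g + 1)) (Ψ : ℤ → MvPowerSeries σ R) (n : ℕ) (g : ℤ) :
    VanishBelow wt n (((n ! : K)⁻¹) • T^[n] Ψ g) := by
  rw [iterate_eq_sum_flowTerm D Q T hT]
  exact VanishBelow.sum fun m _ => rapid_flowTerm hD hQ m _ n

/-- The exponential of `Ψ ↦ D Ψ + ħ⁻¹ Q Ψ` is `Ψ ↦ exp(P / ħ) exp(D) Ψ`. -/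
theorem coeffSum_exp_operator
    (hD : ∀ n f, VanishBelow wt n f → VanishBelow wt (n + 1) (D f)) (hQ : VanishBelow wt 1 Q)
    (hT : ∀ Ψ g, T Ψ g = D (Ψ g) + Q * Ψ (g + 1)) (Ψ : ℤ → MvPowerSeries σ R) (g : ℤ) :
    (coeffSum fun n : ℕ => ((n ! : K)⁻¹) • T^[n] Ψ g) =
      coeffSum fun m : ℕ => ((m ! : K)⁻¹) •
        (evalOne wt (flowIntegral D K Q) ^ m * evalOne wt (expFlow D K (Ψ (g + m)))) := by
  simp only [← evalOne_flowTerm hD hQ]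
  ext d
  set N := Finsupp.weight wt d + 1 with hN
  -- At the monomial `d` both sums reduce to the square `n, m < N`: `n` is bounded by weight, and `m
  -- ≤ n` by divisibility by `t^m`. The two finite sums are then interchanged.
  have e1 : ∀ n ∉ Finset.range N, MvPowerSeries.coeff d (((n ! : K)⁻¹) • T^[n] Ψ g) = 0 := by
    intro n hn
    simp only [Finset.mem_range, not_lt] at hn
    exact vanishBelow_iterate_operator hD hQ hT Ψ n g d (by omega)
  have e2 : ∀ m n, n < m → PowerSeries.coeff n (flowTerm D K Q m (Ψ (g + m))) = 0 :=
    fun m n hn => coeff_flowTerm_of_lt D Q _ hn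
  have e3 : ∀ m ∉ Finset.range N,
      MvPowerSeries.coeff d (evalOne wt (flowTerm D K Q m (Ψ (g + m)))) = 0 := by
    intro m hm
    simp only [Finset.mem_range, not_lt] at hm
    rw [(rapid_flowTerm hD hQ m _).coeff_evalOne (N := N) (by omega)]
    refine Finset.sum_eq_zero fun n hn => ?_
    rw [e2 m n ((Finset.mem_range.1 hn).trans_le hm), map_zero]
  rw [coeff_coeffSum, coeff_coeffSum, finsum_eq_sum_of_support_subset (s := Finset.range N) _
    fun n hn => by_contra fun h => hn (e1 n h), finsum_eq_sum_of_support_subset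
    (s := Finset.range N) _ fun n hn => by_contra fun h => hn (e3 n h)]
  have e4 : ∀ m, MvPowerSeries.coeff d (evalOne wt (flowTerm D K Q m (Ψ (g + m)))) =
      ∑ n ∈ Finset.range N, MvPowerSeries.coeff d
        (PowerSeries.coeff n (flowTerm D K Q m (Ψ (g + m)))) := fun m =>
    (rapid_flowTerm hD hQ m _).coeff_evalOne (N := N) (by omega)
  simp only [e4]
  rw [Finset.sum_comm]
  refine Finset.sum_congr rfl fun n hn => ?_
  rw [iterate_eq_sum_flowTerm D Q T hT, map_sum]
  refine Finset.sum_subset (Finset.range_subset_range.2 (Finset.mem_range.1 hn)) fun m _ hm => ?_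
  rw [e2 m n (by simpa using hm), map_zero]

end FlowEvaluation

/-! ### Exponentials of series in `z⁻¹` -/

section ExpSeries

variable {K : Type*} [Field K] [CharZero K]

theorem inv_factorial_smul_add_pow {A : Type*} [Ring A] [Algebra K A] {x y : A} (h : Commute x y)
    (n : ℕ) : ((n ! : K)⁻¹) • (x + y) ^ n = ∑ p ∈ Finset.HasAntidiagonal.antidiagonal n,
      ((p.1 ! : K)⁻¹ * (p.2 ! : K)⁻¹) • (x ^ p.1 * y ^ p.2) := by
  rw [h.add_pow', Finset.smul_sum]
  refine Finset.sum_congr rfl fun p hp => ?_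
  rw [Finset.HasAntidiagonal.mem_antidiagonal] at hp
  rw [← Nat.cast_smul_eq_nsmul K, smul_smul]
  congr 1
  have h1 : ((n.choose p.1 : K)) * (p.1 ! : K) * (p.2 ! : K) = (n ! : K) := by
    rw [← hp, Nat.choose_symm_add]
    exact_mod_cast Nat.add_choose_mul_factorial_mul_factorial p.1 p.2
  have h2 : (n ! : K) ≠ 0 := by exact_mod_cast n.factorial_ne_zero
  have h3 : (p.1 ! : K) ≠ 0 := by exact_mod_cast p.1.factorial_ne_zero
  have h4 : (p.2 ! : K) ≠ 0 := by exact_mod_cast p.2.factorial_ne_zero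
  field_simp
  linear_combination h1

variable {H : Type*} [AddCommGroup H] [Module K H]

theorem coeff_pow_of_lt {E : Type*} [Ring E] {A : PowerSeries E}
    (hA : PowerSeries.coeff 0 A = 0) {n k : ℕ} (h : k < n) : PowerSeries.coeff k (A ^ n) = 0 := by
  induction n generalizing k with
  | zero => omega
  | succ n ih =>
    rw [pow_succ', PowerSeries.coeff_mul]
    refine Finset.sum_eq_zero fun p hp => ?_
    rw [Finset.HasAntidiagonal.mem_antidiagonal] at hp
    rcases Nat.eq_zero_or_pos p.1 with h0 | h0
    · rw [h0, hA, zero_mul]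
    · rw [ih (by omega), mul_zero]

omit [CharZero K] in
theorem coeff_expSeries {A : PowerSeries (Module.End K H)} (hA : PowerSeries.coeff 0 A = 0)
    {k N : ℕ} (h : k < N) : PowerSeries.coeff k (expSeries A) =
      ∑ n ∈ Finset.range N, ((n ! : K)⁻¹) • PowerSeries.coeff k (A ^ n) := by
  rw [expSeries, PowerSeries.coeff_mk]
  refine Finset.sum_subset (Finset.range_subset_range.2 h) fun n _ hn => ?_
  rw [coeff_pow_of_lt hA (by simpa using hn), smul_zero]

/-- The binomial theorem applies degree by degree: products `Aⁱ A'ʲ` with `i + j > k` do not reach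
`z⁻ᵏ`. -/
theorem expSeries_mul_expSeries {A A' : PowerSeries (Module.End K H)}
    (hA : PowerSeries.coeff 0 A = 0) (hA' : PowerSeries.coeff 0 A' = 0) (h : Commute A A') :
    expSeries A * expSeries A' = expSeries (A + A') := by
  ext1 k
  have hsum : PowerSeries.coeff 0 (A + A') = 0 := by rw [map_add, hA, hA', add_zero]
  have hz : ∀ i j, k + 1 ≤ i + j → ((i ! : K)⁻¹ * (j ! : K)⁻¹) •
      PowerSeries.coeff k (A ^ i * A' ^ j) = 0 := by
    intro i j hij
    rw [PowerSeries.coeff_mul, Finset.sum_eq_zero, smul_zero]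
    intro p hp
    rw [Finset.HasAntidiagonal.mem_antidiagonal] at hp
    by_cases h1 : p.1 < i
    · rw [coeff_pow_of_lt hA h1, zero_mul]
    · rw [coeff_pow_of_lt hA' (by omega), mul_zero]
  rw [coeff_expSeries hsum k.lt_succ_self]
  have e : ∀ n, ((n ! : K)⁻¹) • PowerSeries.coeff k ((A + A') ^ n) =
      ∑ p ∈ Finset.HasAntidiagonal.antidiagonal n, ((p.1 ! : K)⁻¹ * (p.2 ! : K)⁻¹) •
        PowerSeries.coeff k (A ^ p.1 * A' ^ p.2) := by
    intro n
    have := congrArg (PowerSeries.coeff k) (inv_factorial_smul_add_pow (K := K) h n)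
    rw [map_sum] at this
    exact this
  simp only [e]
  rw [sum_range_antidiagonal (fun i j => ((i ! : K)⁻¹ * (j ! : K)⁻¹) •
    PowerSeries.coeff k (A ^ i * A' ^ j)) hz, PowerSeries.coeff_mul]
  simp only [PowerSeries.coeff_mul, Finset.smul_sum]
  simp only [Finset.sum_comm (t := Finset.HasAntidiagonal.antidiagonal k)]
  refine Finset.sum_congr rfl fun p hp => ?_
  rw [Finset.HasAntidiagonal.mem_antidiagonal] at hp
  rw [coeff_expSeries hA (show p.1 < k + 1 by omega),
    coeff_expSeries hA' (show p.2 < k + 1 by omega), Finset.sum_mul_sum]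
  simp only [smul_mul_smul_comm]

omit [CharZero K] in
theorem expSeries_zero : expSeries (0 : PowerSeries (Module.End K H)) = 1 := by
  ext1 k
  rw [coeff_expSeries (map_zero _) k.lt_succ_self, Finset.sum_range_succ', Finset.sum_eq_zero]
  · simp
  · intro n _
    rw [zero_pow n.succ_ne_zero, map_zero, smul_zero]

theorem expSeries_mul_neg {A : PowerSeries (Module.End K H)} (hA : PowerSeries.coeff 0 A = 0) :
    expSeries A * expSeries (-A) = 1 := by
  rw [expSeries_mul_expSeries hA (by rw [map_neg, hA, neg_zero]) (Commute.neg_right rfl),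
    add_neg_cancel, expSeries_zero]

theorem expSeries_neg_mul {A : PowerSeries (Module.End K H)} (hA : PowerSeries.coeff 0 A = 0) :
    expSeries (-A) * expSeries A = 1 := by
  rw [expSeries_mul_expSeries (by rw [map_neg, hA, neg_zero]) hA (Commute.neg_left rfl),
    neg_add_cancel, expSeries_zero]

end ExpSeries

/-! ### Adjoints with respect to the pairing -/

section Adjoint

variable {K H : Type*} [Field K] [AddCommGroup H] [Module K H] [FiniteDimensional K H]
  (B : LinearMap.BilinForm K H) (hB : B.Nondegenerate)

theorem apply_adj (M : Module.End K H) (x y : H) : B (adj B hB M x) y = B x (M y) :=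
  LinearMap.BilinForm.isAdjointPairLeftAdjointOfNondegenerate B hB M x y

variable {B}

omit [FiniteDimensional K H] in
include hB in
theorem End.ext_of_apply {M N : Module.End K H} (h : ∀ x y, B (M x) y = B (N x) y) : M = N := by
  ext x
  rw [← sub_eq_zero]
  refine hB.1 _ fun y => ?_
  rw [map_sub, LinearMap.sub_apply, h, sub_self]

theorem adj_mul (M N : Module.End K H) : adj B hB (M * N) = adj B hB N * adj B hB M :=
  End.ext_of_apply hB fun x y => by
    rw [apply_adj, Module.End.mul_apply, Module.End.mul_apply, apply_adj, apply_adj]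

theorem adj_add (M N : Module.End K H) : adj B hB (M + N) = adj B hB M + adj B hB N :=
  End.ext_of_apply hB fun x y => by
    rw [apply_adj, LinearMap.add_apply, LinearMap.add_apply, map_add, map_add,
      LinearMap.add_apply, apply_adj, apply_adj]

theorem adj_smul (c : K) (M : Module.End K H) : adj B hB (c • M) = c • adj B hB M :=
  End.ext_of_apply hB fun x y => by
    rw [apply_adj, LinearMap.smul_apply, LinearMap.smul_apply, map_smul, map_smul,
      LinearMap.smul_apply, apply_adj]

theorem adj_one : adj B hB 1 = 1 :=
  End.ext_of_apply hB fun x y => by rw [apply_adj, Module.End.one_apply, Module.End.one_apply]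

/-- The adjoint as a linear map. -/
def adjLinear : Module.End K H →ₗ[K] Module.End K H where
  toFun := adj B hB
  map_add' := adj_add hB
  map_smul' := adj_smul hB

/-- The coefficientwise adjoint of a series. -/
def adjSeries (P : PowerSeries (Module.End K H)) : PowerSeries (Module.End K H) :=
  PowerSeries.mk fun n => adj B hB (PowerSeries.coeff n P)

theorem adjSeries_mul (P Q : PowerSeries (Module.End K H)) :
    adjSeries hB (P * Q) = adjSeries hB Q * adjSeries hB P := by
  ext1 n
  rw [adjSeries, PowerSeries.coeff_mk, PowerSeries.coeff_mul, PowerSeries.coeff_mul]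
  conv_rhs => rw [← Finset.Nat.sum_antidiagonal_swap]
  have := map_sum (adjLinear hB) (fun p : ℕ × ℕ => PowerSeries.coeff p.1 P *
    PowerSeries.coeff p.2 Q) (Finset.HasAntidiagonal.antidiagonal n)
  refine this.trans (Finset.sum_congr rfl fun p _ => ?_)
  rw [adjSeries, adjSeries, PowerSeries.coeff_mk, PowerSeries.coeff_mk]
  exact adj_mul hB _ _

theorem adjSeries_one : adjSeries hB 1 = 1 := by
  ext1 n
  rw [adjSeries, PowerSeries.coeff_mk, PowerSeries.coeff_one]
  split_ifs
  · exact adj_one hB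
  · exact (adjLinear hB).map_zero

theorem adjSeries_pow (P : PowerSeries (Module.End K H)) (n : ℕ) :
    adjSeries hB (P ^ n) = adjSeries hB P ^ n := by
  induction n with
  | zero => rw [pow_zero, pow_zero, adjSeries_one]
  | succ n ih => rw [pow_succ', adjSeries_mul, ih, pow_succ]

/-- The adjoint is linear and reverses products, hence it respects powers of a single series, and
`S* = exp(A*)`. -/
theorem adj_coeff_expSeries (A : PowerSeries (Module.End K H)) (k : ℕ) :
    adj B hB (PowerSeries.coeff k (expSeries A)) =
      PowerSeries.coeff k (expSeries (adjSeries hB A)) := by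
  rw [expSeries, expSeries, PowerSeries.coeff_mk, PowerSeries.coeff_mk]
  refine (map_sum (adjLinear hB) _ _).trans (Finset.sum_congr rfl fun n _ => ?_)
  rw [map_smul, ← adjSeries_pow, adjSeries, PowerSeries.coeff_mk]
  rfl

end Adjoint

/-! ### Series in `z⁻¹` and `w⁻¹` with noncommuting coefficients -/

section TwoVariables

variable {K E : Type*} [Field K] [Ring E] [Algebra K E]

/-- The coefficient of `z⁻ᵏ w⁻ˡ` in a series in `w⁻¹` over the series in `z⁻¹`. -/
def coeff₂ (k l : ℕ) (F : PowerSeries (PowerSeries E)) : E :=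
  PowerSeries.coeff k (PowerSeries.coeff l F)

theorem ext_coeff₂ {F G : PowerSeries (PowerSeries E)} (h : ∀ k l, coeff₂ k l F = coeff₂ k l G) :
    F = G := by
  ext l k
  exact h k l

theorem coeff₂_add (k l : ℕ) (F G : PowerSeries (PowerSeries E)) :
    coeff₂ k l (F + G) = coeff₂ k l F + coeff₂ k l G := rfl

theorem coeff₂_smul (k l : ℕ) (c : K) (F : PowerSeries (PowerSeries E)) :
    coeff₂ k l (c • F) = c • coeff₂ k l F := rfl

theorem coeff₂_sum {I : Type*} (k l : ℕ) (s : Finset I) (F : I → PowerSeries (PowerSeries E)) :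
    coeff₂ k l (∑ i ∈ s, F i) = ∑ i ∈ s, coeff₂ k l (F i) := by
  rw [coeff₂, map_sum, map_sum]
  rfl

/-- A series in `z⁻¹`, as a series in two variables. -/
def zSeries (P : PowerSeries E) : PowerSeries (PowerSeries E) := PowerSeries.C P

/-- The series `P(w)`, as a series in two variables. -/
def wSeries (P : PowerSeries E) : PowerSeries (PowerSeries E) :=
  PowerSeries.map (PowerSeries.C : E →+* PowerSeries E) P

theorem zSeries_pow (P : PowerSeries E) (n : ℕ) : zSeries (P ^ n) = zSeries P ^ n :=
  map_pow _ _ _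

theorem wSeries_pow (P : PowerSeries E) (n : ℕ) : wSeries (P ^ n) = wSeries P ^ n :=
  map_pow _ _ _

theorem coeff₂_wSeries_mul (P : PowerSeries E) (F : PowerSeries (PowerSeries E)) (k l : ℕ) :
    coeff₂ k l (wSeries P * F) = ∑ p ∈ Finset.HasAntidiagonal.antidiagonal l,
      PowerSeries.coeff p.1 P * coeff₂ k p.2 F := by
  rw [coeff₂, PowerSeries.coeff_mul, map_sum]
  refine Finset.sum_congr rfl fun p _ => ?_
  rw [wSeries, PowerSeries.coeff_map, PowerSeries.coeff_C_mul]
  rfl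

theorem coeff₂_mul_zSeries (P : PowerSeries E) (F : PowerSeries (PowerSeries E)) (k l : ℕ) :
    coeff₂ k l (F * zSeries P) = ∑ p ∈ Finset.HasAntidiagonal.antidiagonal k,
      coeff₂ p.1 l F * PowerSeries.coeff p.2 P := by
  rw [coeff₂, zSeries, PowerSeries.coeff_mul_C, PowerSeries.coeff_mul]
  rfl

theorem coeff₂_wSeries_mul_zSeries (P Q : PowerSeries E) (k l : ℕ) :
    coeff₂ k l (wSeries P * zSeries Q) = PowerSeries.coeff l P * PowerSeries.coeff k Q := by
  rw [coeff₂, zSeries, PowerSeries.coeff_mul_C, wSeries, PowerSeries.coeff_map,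
    PowerSeries.coeff_C_mul]

theorem coeff₂_one (k l : ℕ) : coeff₂ k l (1 : PowerSeries (PowerSeries E)) =
    if k = 0 ∧ l = 0 then 1 else 0 := by
  rw [coeff₂, PowerSeries.coeff_one]
  split_ifs with h1 h2 h2
  · rw [h2.1, PowerSeries.coeff_zero_one]
  · rw [PowerSeries.coeff_one, if_neg (by tauto)]
  · tauto
  · rw [map_zero]

variable (E) in
/-- The series `w⁻¹ + z⁻¹`. -/
def sumVars : PowerSeries (PowerSeries E) := PowerSeries.X + PowerSeries.C PowerSeries.X

theorem coeff₂_sumVars_mul (F : PowerSeries (PowerSeries E)) (k l : ℕ) :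
    coeff₂ k l (sumVars E * F) = (if l = 0 then 0 else coeff₂ k (l - 1) F) +
      (if k = 0 then 0 else coeff₂ (k - 1) l F) := by
  rw [sumVars, add_mul, coeff₂_add, coeff₂, coeff₂, PowerSeries.coeff_C_mul]
  congr 1
  · cases l with
    | zero => rw [PowerSeries.coeff_zero_X_mul, map_zero, if_pos rfl]
    | succ l => rw [PowerSeries.coeff_succ_X_mul, if_neg l.succ_ne_zero]; rfl
  · cases k with
    | zero => rw [PowerSeries.coeff_zero_X_mul, if_pos rfl]
    | succ k => rw [PowerSeries.coeff_succ_X_mul, if_neg k.succ_ne_zero]; rfl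

theorem sumVars_mul_comm (F : PowerSeries (PowerSeries E)) : sumVars E * F = F * sumVars E := by
  rw [sumVars, add_mul, mul_add, PowerSeries.X_mul]
  congr 1
  ext1 l
  rw [PowerSeries.coeff_C_mul, PowerSeries.coeff_mul_C, PowerSeries.X_mul]

variable (K) in
/-- The operator `F ↦ P(w) F + F Q(z)`. -/
def twoSided (P Q : PowerSeries E) : Module.End K (PowerSeries (PowerSeries E)) :=
  LinearMap.mulLeft K (wSeries P) + LinearMap.mulRight K (zSeries Q)

theorem twoSided_apply (P Q : PowerSeries E) (F : PowerSeries (PowerSeries E)) :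
    twoSided K P Q F = wSeries P * F + F * zSeries Q := rfl

theorem sumVars_mul_twoSided_pow (P Q : PowerSeries E) (n : ℕ) (F : PowerSeries (PowerSeries E)) :
    sumVars E * (twoSided K P Q ^ n) F = (twoSided K P Q ^ n) (sumVars E * F) := by
  induction n with
  | zero => rfl
  | succ n ih =>
    rw [pow_succ', Module.End.mul_apply, Module.End.mul_apply, ← ih, twoSided_apply,
      twoSided_apply, mul_add, ← mul_assoc, sumVars_mul_comm (wSeries P), mul_assoc, mul_assoc]

/-- Without constant terms in `P` and `Q`, each application of the operator raises the total degree
by at least one. -/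
theorem coeff₂_twoSided_pow_of_lt {P Q : PowerSeries E} (hP : PowerSeries.coeff 0 P = 0)
    (hQ : PowerSeries.coeff 0 Q = 0) (F : PowerSeries (PowerSeries E)) {n k l : ℕ}
    (h : k + l < n) : coeff₂ k l ((twoSided K P Q ^ n) F) = 0 := by
  induction n generalizing k l with
  | zero => omega
  | succ n ih =>
    rw [pow_succ', Module.End.mul_apply, twoSided_apply, coeff₂_add, coeff₂_wSeries_mul,
      coeff₂_mul_zSeries, Finset.sum_eq_zero, Finset.sum_eq_zero, add_zero]
    · intro p hp
      rw [Finset.HasAntidiagonal.mem_antidiagonal] at hp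
      rcases Nat.eq_zero_or_pos p.2 with h0 | h0
      · rw [h0, hQ, mul_zero]
      · rw [ih (by omega), zero_mul]
    · intro p hp
      rw [Finset.HasAntidiagonal.mem_antidiagonal] at hp
      rcases Nat.eq_zero_or_pos p.1 with h0 | h0
      · rw [h0, hP, zero_mul]
      · rw [ih (by omega), mul_zero]

variable [CharZero K]

/-- Left and right multiplications commute even when coefficients do not. Summed over `n`, this is
`exp(L) 1 = exp(P(w)) exp(Q(z))`. -/
theorem inv_factorial_smul_twoSided_pow_one (P Q : PowerSeries E) (n : ℕ) :
    ((n ! : K)⁻¹) • (twoSided K P Q ^ n) 1 = ∑ p ∈ Finset.HasAntidiagonal.antidiagonal n,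
      ((p.1 ! : K)⁻¹ * (p.2 ! : K)⁻¹) • (wSeries (P ^ p.1) * zSeries (Q ^ p.2)) := by
  have h := LinearMap.congr_fun (inv_factorial_smul_add_pow (K := K)
    (LinearMap.commute_mulLeft_right (R := K) (wSeries P) (zSeries Q)) n) 1
  rw [LinearMap.smul_apply, LinearMap.sum_apply] at h
  refine h.trans (Finset.sum_congr rfl fun p _ => ?_)
  rw [LinearMap.smul_apply, Module.End.mul_apply, LinearMap.pow_mulLeft, LinearMap.pow_mulRight,
    LinearMap.mulRight_apply, LinearMap.mulLeft_apply, one_mul, wSeries_pow, zSeries_pow]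

end TwoVariables

/-! ### Existence and uniqueness of the coefficients `W` -/

section WCoefficients

variable {K H : Type*} [Field K] [AddCommGroup H] [Module K H]

theorem coeff_X_mul_doubleSeries_one (W : ℕ → ℕ → Module.End K H) (d : Fin 2 →₀ ℕ) :
    MvPowerSeries.coeff d (MvPowerSeries.X 1 * doubleSeries W) =
      if d 1 = 0 then 0 else W (d 0) (d 1 - 1) := by
  classical
  rw [MvPowerSeries.X_def, MvPowerSeries.coeff_monomial_mul]
  by_cases h : d 1 = 0
  · rw [if_pos h, if_neg]
    intro h'
    have := h' 1
    rw [Finsupp.single_eq_same] at this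
    omega
  · rw [if_neg h, if_pos (by rw [Finsupp.single_le_iff]; omega), one_mul]
    change W ((d - Finsupp.single 1 1 : Fin 2 →₀ ℕ) 0) ((d - Finsupp.single 1 1 : Fin 2 →₀ ℕ) 1) = _
    simp

theorem coeff_X_mul_doubleSeries_zero (W : ℕ → ℕ → Module.End K H) (d : Fin 2 →₀ ℕ) :
    MvPowerSeries.coeff d (MvPowerSeries.X 0 * doubleSeries W) =
      if d 0 = 0 then 0 else W (d 0 - 1) (d 1) := by
  classical
  rw [MvPowerSeries.X_def, MvPowerSeries.coeff_monomial_mul]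
  by_cases h : d 0 = 0
  · rw [if_pos h, if_neg]
    intro h'
    have := h' 0
    rw [Finsupp.single_eq_same] at this
    omega
  · rw [if_neg h, if_pos (by rw [Finsupp.single_le_iff]; omega), one_mul]
    change W ((d - Finsupp.single 0 1 : Fin 2 →₀ ℕ) 0) ((d - Finsupp.single 0 1 : Fin 2 →₀ ℕ) 1) = _
    simp

variable [FiniteDimensional K H] {B : LinearMap.BilinForm K H} (hB : B.Nondegenerate)

theorem isWCoeff_iff (S : PowerSeries (Module.End K H)) (W : ℕ → ℕ → Module.End K H) :
    IsWCoeff B hB S W ↔ ∀ k l, (if l = 0 then 0 else W k (l - 1)) +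
      (if k = 0 then 0 else W (k - 1) l) =
        adj B hB (PowerSeries.coeff l S) * PowerSeries.coeff k S -
          if k = 0 ∧ l = 0 then 1 else 0 := by
  classical
  have key : IsWCoeff B hB S W ↔ ∀ d : Fin 2 →₀ ℕ, (if d 1 = 0 then 0 else W (d 0) (d 1 - 1)) +
      (if d 0 = 0 then 0 else W (d 0 - 1) (d 1)) =
        adj B hB (PowerSeries.coeff (d 1) S) * PowerSeries.coeff (d 0) S -
          if d 0 = 0 ∧ d 1 = 0 then 1 else 0 := by
    rw [IsWCoeff, MvPowerSeries.ext_iff]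
    refine forall_congr' fun d => ?_
    have hd : d = 0 ↔ d 0 = 0 ∧ d 1 = 0 := by
      rw [Finsupp.ext_iff, Fin.forall_fin_two]
      rfl
    rw [add_mul, map_add, coeff_X_mul_doubleSeries_one, coeff_X_mul_doubleSeries_zero, map_sub,
      MvPowerSeries.coeff_one]
    simp only [hd]
    rfl
  rw [key]
  refine ⟨fun h k l => ?_, fun h d => h _ _⟩
  have := h (Finsupp.equivFunOnFinite.symm ![k, l])
  simpa using this

/-- The equation at `(k + 1, l)` expresses `W k l` through `W (k + 1) (l - 1)` and known data, so
induction on `l` determines all coefficients. -/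
theorem IsWCoeff.unique {S : PowerSeries (Module.End K H)} {W W' : ℕ → ℕ → Module.End K H}
    (h : IsWCoeff B hB S W) (h' : IsWCoeff B hB S W') : W = W' := by
  rw [isWCoeff_iff] at h h'
  have key : ∀ l k, W k l = W' k l := by
    intro l
    induction l with
    | zero =>
      intro k
      have := (h (k + 1) 0).trans (h' (k + 1) 0).symm
      simpa using this
    | succ l ih =>
      intro k
      have := (h (k + 1) (l + 1)).trans (h' (k + 1) (l + 1)).symm
      simpa [ih] using this
  ext1 k
  ext1 l
  exact key l k

/-- The coefficients `(-1)ˡ A_{k+l+1}` of `(A(z) - A(-w)) / (z⁻¹ + w⁻¹)`. -/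
def hamiltonianKernel (A : PowerSeries (Module.End K H)) :
    PowerSeries (PowerSeries (Module.End K H)) :=
  PowerSeries.mk fun l => PowerSeries.mk fun k => (-1 : K) ^ l • PowerSeries.coeff (k + l + 1) A

omit [FiniteDimensional K H] in
theorem coeff₂_hamiltonianKernel (A : PowerSeries (Module.End K H)) (k l : ℕ) :
    coeff₂ k l (hamiltonianKernel A) = (-1 : K) ^ l • PowerSeries.coeff (k + l + 1) A := by
  rw [coeff₂, hamiltonianKernel, PowerSeries.coeff_mk, PowerSeries.coeff_mk]

/-- The coefficients of the integral over `[0, 1]` of `exp(t A*(w)) a(z, w) exp(t A(z))`, where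
`a` is the kernel of the Hamiltonian. -/
def wCoeff (A : PowerSeries (Module.End K H)) (k l : ℕ) : Module.End K H :=
  ∑ n ∈ Finset.range (k + l + 1), (((n + 1)! : K)⁻¹) •
    coeff₂ k l ((twoSided K (adjSeries hB A) A ^ n) (hamiltonianKernel A))

variable {A : PowerSeries (Module.End K H)}

theorem coeff_zero_adjSeries (hA0 : PowerSeries.coeff 0 A = 0) :
    PowerSeries.coeff 0 (adjSeries hB A) = 0 := by
  rw [adjSeries, PowerSeries.coeff_mk, hA0]
  exact (adjLinear hB).map_zero

theorem wCoeff_eq_sum (hA0 : PowerSeries.coeff 0 A = 0) {k l N : ℕ} (h : k + l < N) :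
    wCoeff hB A k l = ∑ n ∈ Finset.range N, (((n + 1)! : K)⁻¹) •
      coeff₂ k l ((twoSided K (adjSeries hB A) A ^ n) (hamiltonianKernel A)) := by
  refine Finset.sum_subset (Finset.range_subset_range.2 h) fun n _ hn => ?_
  rw [coeff₂_twoSided_pow_of_lt (coeff_zero_adjSeries hB hA0) hA0 _ (by simpa using hn), smul_zero]

theorem adj_coeff (hsymm : B.IsSymm) (hA : IsInfinitesimalSymplectic B A) (m : ℕ) :
    adj B hB (PowerSeries.coeff m A) = -((-1 : K) ^ m • PowerSeries.coeff m A) :=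
  End.ext_of_apply hB fun x y => by
    rw [apply_adj, hsymm.eq x, hA.apply_coeff hsymm, LinearMap.neg_apply, map_neg,
      LinearMap.neg_apply, LinearMap.smul_apply, map_smul, LinearMap.smul_apply, smul_eq_mul,
      hsymm.eq y]

/-- When `k` and `l` are both positive, the two contributions are `A_{k+l}` with opposite signs and
cancel. The axes leave `A(z)` and, by the symplectic condition, `A*(w)`. -/
theorem sumVars_mul_hamiltonianKernel (hsymm : B.IsSymm) (hA0 : PowerSeries.coeff 0 A = 0)
    (hA : IsInfinitesimalSymplectic B A) :
    sumVars (Module.End K H) * hamiltonianKernel A = twoSided K (adjSeries hB A) A 1 := by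
  refine ext_coeff₂ fun k l => ?_
  have e1 : coeff₂ k l (wSeries (adjSeries hB A)) =
      if k = 0 then adj B hB (PowerSeries.coeff l A) else 0 := by
    rw [coeff₂, wSeries, PowerSeries.coeff_map, PowerSeries.coeff_C, adjSeries,
      PowerSeries.coeff_mk]
  have e2 : coeff₂ k l (zSeries A) = if l = 0 then PowerSeries.coeff k A else 0 := by
    rw [coeff₂, zSeries, PowerSeries.coeff_C]
    split_ifs
    · rfl
    · rw [map_zero]
  rw [twoSided_apply, mul_one, one_mul, coeff₂_add, e1, e2, coeff₂_sumVars_mul,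
    adj_coeff hB hsymm hA, coeff₂_hamiltonianKernel, coeff₂_hamiltonianKernel]
  rcases Nat.eq_zero_or_pos k with rfl | hk <;> rcases Nat.eq_zero_or_pos l with rfl | hl
  · simp [hA0]
  · obtain ⟨l, rfl⟩ : ∃ l', l = l' + 1 := ⟨l - 1, by omega⟩
    simp [pow_succ]
  · obtain ⟨k, rfl⟩ : ∃ k', k = k' + 1 := ⟨k - 1, by omega⟩
    simp
  · obtain ⟨l, rfl⟩ : ∃ l', l = l' + 1 := ⟨l - 1, by omega⟩
    obtain ⟨k, rfl⟩ : ∃ k', k = k' + 1 := ⟨k - 1, by omega⟩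
    simp only [Nat.add_sub_cancel, Nat.succ_ne_zero, if_false, add_zero]
    rw [show k + 1 + l + 1 = k + (l + 1) + 1 by omega, pow_succ, mul_neg_one, neg_smul,
      add_neg_cancel]

/-- With `L` the two-sided operator and `a` the kernel, `(z⁻¹ + w⁻¹) ∑ Lⁿ a / (n+1)! = ∑ Lⁿ⁺¹ 1 /
(n+1)! = exp(L) 1 - 1`. -/
theorem isWCoeff_wCoeff [CharZero K] (hsymm : B.IsSymm) (hA0 : PowerSeries.coeff 0 A = 0)
    (hA : IsInfinitesimalSymplectic B A) : IsWCoeff B hB (expSeries A) (wCoeff hB A) := by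
  rw [isWCoeff_iff]
  intro k l
  set P := adjSeries hB A with hP
  have hP0 : PowerSeries.coeff 0 P = 0 := coeff_zero_adjSeries hB hA0
  -- One finite truncation `V` serves every coefficient of total degree at most `k + l`, which
  -- covers all those in the equation at `(k, l)`.
  set N := k + l + 1 with hN
  set V := ∑ n ∈ Finset.range N, (((n + 1)! : K)⁻¹) • (twoSided K P A ^ n) (hamiltonianKernel A)
    with hV
  have hW : ∀ i j, i + j < N → wCoeff hB A i j = coeff₂ i j V := by
    intro i j hij
    rw [wCoeff_eq_sum hB hA0 hij, hV, coeff₂_sum]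
    rfl
  have h1 : (if l = 0 then 0 else wCoeff hB A k (l - 1)) +
      (if k = 0 then 0 else wCoeff hB A (k - 1) l) =
        coeff₂ k l (sumVars (Module.End K H) * V) := by
    rw [coeff₂_sumVars_mul, hW _ _ (by omega), hW _ _ (by omega)]
  have h2 : sumVars (Module.End K H) * V + 1 =
      ∑ n ∈ Finset.range (N + 1), ((n ! : K)⁻¹) • (twoSided K P A ^ n) 1 := by
    rw [Finset.sum_range_succ', hV, Finset.mul_sum]
    congr 1
    · refine Finset.sum_congr rfl fun n _ => ?_
      rw [mul_smul_comm, sumVars_mul_twoSided_pow, sumVars_mul_hamiltonianKernel hB hsymm hA0 hA,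
        pow_succ, Module.End.mul_apply]
    · simp
  have hz : ∀ i j, N + 1 ≤ i + j → coeff₂ k l
      (((i ! : K)⁻¹ * (j ! : K)⁻¹) • (wSeries (P ^ i) * zSeries (A ^ j))) = 0 := by
    intro i j hij
    rw [coeff₂_smul, coeff₂_wSeries_mul_zSeries]
    by_cases h : l < i
    · rw [coeff_pow_of_lt hP0 h, zero_mul, smul_zero]
    · rw [coeff_pow_of_lt hA0 (show k < j by omega), mul_zero, smul_zero]
  have h3 : coeff₂ k l (sumVars (Module.End K H) * V + 1) =
      PowerSeries.coeff l (expSeries P) * PowerSeries.coeff k (expSeries A) := by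
    rw [h2]
    simp only [inv_factorial_smul_twoSided_pow_one, coeff₂_sum]
    rw [sum_range_antidiagonal (fun i j => coeff₂ k l
      (((i ! : K)⁻¹ * (j ! : K)⁻¹) • (wSeries (P ^ i) * zSeries (A ^ j)))) hz,
      coeff_expSeries hP0 (show l < N + 1 by omega), coeff_expSeries hA0 (show k < N + 1 by omega),
      Finset.sum_mul_sum]
    simp only [coeff₂_smul, coeff₂_wSeries_mul_zSeries, smul_mul_smul_comm]
  rw [h1, adj_coeff_expSeries, ← h3, coeff₂_add, coeff₂_one, add_sub_cancel_right]

end WCoefficients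

/-! ### Darboux coordinates and the linear substitution -/

section Coordinates

variable {K H ι R : Type*} [Field K] [AddCommGroup H] [Module K H] [CommRing R] [Algebra K R]
  (b : Module.Basis ι K H)

/-- The `φ_α z^k` component of `T(z) φ_β z^l`, for `i = (k, α)` and `j = (l, β)`. -/
def actMatrix (T : PowerSeries (Module.End K H)) (i j : ℕ × ι) : K :=
  b.repr (zCoeff (act T (qVec b j)) (i.1 : ℤ)) i.2

theorem truncAct_eq_linSeries (S : PowerSeries (Module.End K H)) (i : ℕ × ι) :
    truncAct R b S i = linSeries R (actMatrix b S i) := rfl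

theorem actMatrix_apply (T : PowerSeries (Module.End K H)) (i j : ℕ × ι) :
    actMatrix b T i j =
      if i.1 ≤ j.1 then b.repr (PowerSeries.coeff (j.1 - i.1) T (b j.2)) i.2 else 0 := by
  rw [actMatrix, qVec, zCoeff_act_zMonomial]
  by_cases h : i.1 ≤ j.1
  · rw [if_pos h, if_pos (by exact_mod_cast h), show ((j.1 : ℤ) - i.1).toNat = j.1 - i.1 by omega]
  · rw [if_neg h, if_neg (by exact_mod_cast h), map_zero, Finsupp.zero_apply]

theorem finite_actMatrix [Finite ι] (T : PowerSeries (Module.End K H)) (m : ℕ × ι) :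
    {j | actMatrix b T j m ≠ 0}.Finite := by
  refine ((Set.finite_Iic m.1).prod Set.finite_univ).subset fun j hj => ⟨?_, Set.mem_univ _⟩
  by_contra h
  exact hj (by rw [actMatrix_apply, if_neg (show ¬j.1 ≤ m.1 from h)])

theorem actMatrix_one (i j : ℕ × ι) [DecidableEq ι] :
    actMatrix b 1 i j = if i = j then 1 else 0 := by
  rw [actMatrix_apply, PowerSeries.coeff_one]
  by_cases h : i = j
  · subst h
    simp
  · rw [if_neg h]
    split_ifs with h1 h2
    · rw [Module.End.one_apply, b.repr_self, Finsupp.single_apply, if_neg]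
      intro h3
      exact h (Prod.ext (by omega) h3.symm)
    · rw [LinearMap.zero_apply, map_zero, Finsupp.zero_apply]
    · rfl

theorem finsum_mul_actMatrix [Finite ι] (A : PowerSeries (Module.End K H)) (f : ℕ → H →ₗ[K] K)
    (m : ℕ × ι) : ∑ᶠ i : ℕ × ι, f i.1 (b i.2) * actMatrix b A i m =
      ∑ p ∈ Finset.HasAntidiagonal.antidiagonal m.1, f p.1 (PowerSeries.coeff p.2 A (b m.2)) := by
  classical
  cases nonempty_fintype ι
  rw [Finset.Nat.sum_antidiagonal_eq_sum_range_succ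
      (fun i j => f i (PowerSeries.coeff j A (b m.2))),
    finsum_eq_sum_of_support_subset (s := Finset.range (m.1 + 1) ×ˢ Finset.univ),
    Finset.sum_product]
  · refine Finset.sum_congr rfl fun k hk => ?_
    have hk' : k ≤ m.1 := Nat.lt_succ_iff.1 (Finset.mem_range.1 hk)
    conv_rhs => rw [← b.sum_repr (PowerSeries.coeff (m.1 - k) A (b m.2)), map_sum]
    refine Finset.sum_congr rfl fun α _ => ?_
    rw [actMatrix_apply, if_pos hk', map_smul, smul_eq_mul, mul_comm]
  · intro i hi
    simp only [Finset.coe_product, Set.mem_prod, Finset.mem_coe, Finset.mem_range, Finset.mem_univ,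
      and_true]
    by_contra h
    refine hi ?_
    change _ * _ = _
    rw [actMatrix_apply, if_neg (by omega), mul_zero]

/-- This is `[T[A𝐪]₊]₊ = [TA𝐪]₊`: a series in `z⁻¹` never raises the power of `z`, so what the inner
truncation discards cannot return. -/
theorem actMatrix_mul [Finite ι] (T A : PowerSeries (Module.End K H)) (i m : ℕ × ι) :
    ∑ᶠ j, actMatrix b T i j * actMatrix b A j m = actMatrix b (T * A) i m := by
  have h := finsum_mul_actMatrix b A (fun k => if i.1 ≤ k then
    (b.coord i.2).comp (PowerSeries.coeff (k - i.1) T) else 0) m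
  have e : ∀ j : ℕ × ι, actMatrix b T i j = (if i.1 ≤ j.1 then
      (b.coord i.2).comp (PowerSeries.coeff (j.1 - i.1) T) else 0 : H →ₗ[K] K) (b j.2) := by
    intro j
    rw [actMatrix_apply]
    split_ifs <;> rfl
  simp only [e]
  rw [h, actMatrix_apply]
  rw [Finset.Nat.sum_antidiagonal_eq_sum_range_succ (fun k l => (if i.1 ≤ k then
    (b.coord i.2).comp (PowerSeries.coeff (k - i.1) T) else 0 : H →ₗ[K] K)
      (PowerSeries.coeff l A (b m.2)))]
  split_ifs with hi
  · obtain ⟨r, hr⟩ := Nat.exists_eq_add_of_le hi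
    rw [hr, Nat.succ_eq_add_one, add_assoc, Finset.sum_range_add, Finset.sum_eq_zero, zero_add, Nat.add_sub_cancel_left,
      PowerSeries.coeff_mul, Finset.Nat.sum_antidiagonal_eq_sum_range_succ
        (fun k l => PowerSeries.coeff k T * PowerSeries.coeff l A), LinearMap.sum_apply, map_sum,
      Finsupp.finsetSum_apply]
    · refine Finset.sum_congr rfl fun k hk => ?_
      rw [if_pos (Nat.le_add_right _ _), Nat.add_sub_cancel_left, Nat.add_sub_add_left]
      rfl
    · intro k hk
      rw [if_neg (not_le.2 (Finset.mem_range.1 hk)), LinearMap.zero_apply]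
  · refine Finset.sum_eq_zero fun k hk => ?_
    rw [Finset.mem_range] at hk
    rw [if_neg (by omega), LinearMap.zero_apply]

theorem linSeries_actMatrix_one (i : ℕ × ι) :
    linSeries R (actMatrix b 1 i) = MvPowerSeries.X i := by
  classical
  ext d
  rw [linSeries, coeff_coeffSum, finsum_eq_single _ i]
  · rw [actMatrix_one, if_pos rfl, one_smul]
  · intro j hj
    rw [actMatrix_one, if_neg hj.symm, zero_smul, map_zero]

/-- The scalar identity is required only at indices contributing to the monomial `d`, so a cutoff
depending on `d` can be used for exponential sums. -/
theorem coeff_coeffSum_smul_eq_sum {σ I J : Type*} {F : I → MvPowerSeries σ R}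
    (hF : CoeffFinite F) {c : I → K} {s : Finset J} {a : J → K} {c' : J → I → K} {d : σ →₀ ℕ}
    (h : ∀ i, MvPowerSeries.coeff d (F i) ≠ 0 → c i = ∑ n ∈ s, a n * c' n i) :
    MvPowerSeries.coeff d (coeffSum fun i => c i • F i) =
      ∑ n ∈ s, a n • MvPowerSeries.coeff d (coeffSum fun i => c' n i • F i) := by
  have hsup : ∀ c : I → K, (Function.support fun i => MvPowerSeries.coeff d (c i • F i)) ⊆
      (hF d).toFinset := by
    intro c i hi
    rw [Set.Finite.coe_toFinset]
    intro h0
    exact hi (by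
      change MvPowerSeries.coeff d (c i • F i) = 0
      rw [coeff_algebra_smul, h0, smul_zero])
  simp only [coeff_coeffSum, finsum_eq_sum_of_support_subset _ (hsup _), Finset.smul_sum]
  rw [Finset.sum_comm]
  refine Finset.sum_congr rfl fun i hi => ?_
  rw [coeff_algebra_smul, h i ((hF d).mem_toFinset.1 hi), Finset.sum_smul]
  simp only [coeff_algebra_smul, smul_smul]

/-- The weight of the variable `q_k^α`. -/
abbrev varWeight (i : ℕ × ι) : ℕ := i.1 + 1

theorem finite_weight_lt [Finite ι] (N : ℕ) :
    {d : ℕ × ι →₀ ℕ | Finsupp.weight varWeight d < N}.Finite := by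
  classical
  cases nonempty_fintype ι
  -- Every variable has weight at least one and `q_k^α` has weight above `k`, so weight below `N`
  -- bounds both the exponents and the indices `k`.
  refine (Set.finite_Iic (∑ i ∈ Finset.range N ×ˢ (Finset.univ : Finset ι),
    Finsupp.single i N)).subset fun d hd i => ?_
  simp only [Set.mem_ofPred_eq] at hd
  have h1 : d i ≤ Finsupp.weight varWeight d := Finsupp.le_weight varWeight (by simp) d
  by_cases h : d i = 0
  · rw [h]; exact Nat.zero_le _
  · have h2 : varWeight i ≤ Finsupp.weight varWeight d :=
      Finsupp.le_weight_of_ne_zero' varWeight h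
    have hi : i ∈ Finset.range N ×ˢ (Finset.univ : Finset ι) := by
      simp only [Finset.mem_product, Finset.mem_range, Finset.mem_univ, and_true]
      simp only [varWeight] at h2
      omega
    rw [Finsupp.finsetSum_apply]
    refine le_trans ?_ (Finset.single_le_sum (fun _ _ => Nat.zero_le _) hi)
    rw [Finsupp.single_eq_same]
    omega

variable {b}

theorem weight_of_coeff_X_ne_zero {d : ℕ × ι →₀ ℕ} {j : ℕ × ι}
    (h : MvPowerSeries.coeff d (MvPowerSeries.X j : MvPowerSeries (ℕ × ι) R) ≠ 0) :
    j.1 < Finsupp.weight varWeight d := by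
  by_contra h'
  refine h (vanishBelow_X (wt := varWeight) j d ?_)
  change _ < j.1 + 1
  omega

theorem weight_of_coeff_X_mul_X_ne_zero {d : ℕ × ι →₀ ℕ} {i j : ℕ × ι}
    (h : MvPowerSeries.coeff d (MvPowerSeries.X i * MvPowerSeries.X j :
      MvPowerSeries (ℕ × ι) R) ≠ 0) : i.1 + j.1 < Finsupp.weight varWeight d := by
  by_contra h'
  refine h ((vanishBelow_X (wt := varWeight) i).mul (vanishBelow_X j) d ?_)
  change _ < i.1 + 1 + (j.1 + 1)
  omega

theorem vanishBelow_linSeries {c : ℕ × ι → K} {n : ℕ} (hc : ∀ j, c j ≠ 0 → n ≤ j.1) :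
    VanishBelow varWeight (n + 1) (linSeries R c) := by
  refine VanishBelow.coeffSum fun j => ?_
  by_cases h : c j = 0
  · rw [h, zero_smul]; exact VanishBelow.zero_fun _
  · exact ((vanishBelow_X j).mono (Nat.succ_le_succ (hc j h))).smul _

theorem vanishBelow_quadSeries (c : (ℕ × ι) × (ℕ × ι) → K) :
    VanishBelow varWeight 1 (quadSeries R c) :=
  VanishBelow.coeffSum fun p => (((vanishBelow_X p.1).mul (vanishBelow_X p.2)).mono
    (by simp only [varWeight]; omega)).smul _

variable (b)

theorem hasSubst_truncAct [Finite ι] (S : PowerSeries (Module.End K H)) :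
    MvPowerSeries.HasSubst (truncAct R b S) where
  const_coeff i := by
    rw [truncAct_eq_linSeries, ← MvPowerSeries.coeff_zero_eq_constantCoeff_apply,
      vanishBelow_linSeries (n := 0) (fun _ _ => Nat.zero_le _) 0 (by simp)]
    exact IsNilpotent.zero
  coeff_zero d := coeffFinite_linSeries (finite_actMatrix b S) d

variable (R) in
/-- The vector field `𝐪 ↦ [A 𝐪]₊`, as a derivation. -/
def linearField [Finite ι] (A : PowerSeries (Module.End K H)) :
    Derivation R (MvPowerSeries (ℕ × ι) R) (MvPowerSeries (ℕ × ι) R) :=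
  vectorField _ (coeffFinite_linSeries (R := R) (finite_actMatrix b A))

/-- As `A` has no constant term, the `(k, α)` component of the field involves only variables `q_m`
with `m > k`. -/
theorem vanishBelow_linearField [Finite ι] {A : PowerSeries (Module.End K H)}
    (hA0 : PowerSeries.coeff 0 A = 0) {n : ℕ} {f : MvPowerSeries (ℕ × ι) R}
    (hf : VanishBelow varWeight n f) : VanishBelow varWeight (n + 1) (linearField R b A f) := by
  refine vanishBelow_vectorField _ (fun j => vanishBelow_linSeries fun m hm => ?_) hf
  by_contra h
  refine hm ?_
  rw [actMatrix_apply]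
  split_ifs with h1
  · rw [show m.1 - j.1 = 0 by simp only [varWeight] at h; omega, hA0, LinearMap.zero_apply,
      map_zero, Finsupp.zero_apply]
  · rfl

theorem iterate_linearField_X [Finite ι] (A : PowerSeries (Module.End K H)) (n : ℕ)
    (i : ℕ × ι) : (linearField R b A)^[n] (MvPowerSeries.X i) =
      linSeries R (actMatrix b (A ^ n) i) := by
  induction n with
  | zero => rw [pow_zero, linSeries_actMatrix_one]; rfl
  | succ n ih =>
    rw [Function.iterate_succ_apply', ih, linearField,
      vectorField_linSeries (finite_actMatrix b A)]
    simp only [actMatrix_mul, pow_succ]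

theorem evalOne_expFlow_X [Finite ι] {A : PowerSeries (Module.End K H)}
    (hA0 : PowerSeries.coeff 0 A = 0) (i : ℕ × ι) :
    evalOne varWeight (expFlow (linearField R b A) K (MvPowerSeries.X i)) =
      truncAct R b (expSeries A) i := by
  ext d
  rw [coeff_evalOne_def]
  simp only [expFlow, PowerSeries.coeff_mk, iterate_linearField_X, coeff_algebra_smul]
  -- A variable `q_l^β` occurring at `d` has `l` below the weight of `d`, so the powers of `A` kept
  -- by the cutoff already give the exact coefficient of `exp(A)`.
  refine (coeff_coeffSum_smul_eq_sum coeffFinite_X fun j hj => ?_).symm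
  have hj' := weight_of_coeff_X_ne_zero hj
  change actMatrix b (expSeries A) i j = _
  simp only [actMatrix_apply]
  split_ifs
  · rw [coeff_expSeries hA0 (show j.1 - i.1 < Finsupp.weight varWeight d + 1 by omega),
      LinearMap.sum_apply, map_sum, Finsupp.finsetSum_apply]
    simp
  · simp

end Coordinates

/-! ### The quadratic Hamiltonian in Darboux coordinates -/

section Hamiltonian

variable {K H ι R : Type*} [Field K] [AddCommGroup H] [Module K H] [CommRing R] [Algebra K R]
  {B : LinearMap.BilinForm K H} (b : Module.Basis ι K H)

variable (B) in
/-- The matrix of the quadratic form `∑ (F k l 𝐪_k, 𝐪_l)`. -/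
def kernelMatrix (F : ℕ → ℕ → Module.End K H) (p : (ℕ × ι) × (ℕ × ι)) : K :=
  B (F p.1.1 p.2.1 (b p.1.2)) (b p.2.2)

/-- Replacing `𝐪_k` by its image multiplies the kernel by `A(z)` on the right; replacing `𝐪_l` and
passing to the adjoint multiplies it by `A*(w)` on the left. -/
theorem linearField_quadSeries [Finite ι] [FiniteDimensional K H] (hB : B.Nondegenerate)
    (A : PowerSeries (Module.End K H)) (F : PowerSeries (PowerSeries (Module.End K H))) :
    linearField R b A (quadSeries R (kernelMatrix B b fun k l => coeff₂ k l F)) =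
      quadSeries R (kernelMatrix B b fun k l =>
        coeff₂ k l (twoSided K (adjSeries hB A) A F)) := by
  rw [linearField, vectorField_quadSeries (finite_actMatrix b A)]
  congr 1
  ext1 p
  have h1 := finsum_mul_actMatrix b A
    (fun k => (B.flip (b p.2.2)).comp (coeff₂ k p.2.1 F)) p.1
  have h2 := finsum_mul_actMatrix b A
    (fun l => B (coeff₂ p.1.1 l F (b p.1.2))) p.2
  refine (congrArg₂ (· + ·) h1 h2).trans ?_
  rw [kernelMatrix, twoSided_apply, coeff₂_add, coeff₂_wSeries_mul, coeff₂_mul_zSeries,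
    LinearMap.add_apply, map_add, LinearMap.add_apply, add_comm, ← Finset.Nat.sum_antidiagonal_swap,
    LinearMap.sum_apply, LinearMap.sum_apply, map_sum, map_sum, LinearMap.sum_apply,
    LinearMap.sum_apply]
  congr 1
  refine Finset.sum_congr rfl fun q _ => ?_
  rw [Module.End.mul_apply, adjSeries, PowerSeries.coeff_mk, apply_adj]
  rfl

theorem apply_dualBasis_eq_repr [Finite ι] [DecidableEq ι] (hsymm : B.IsSymm)
    (hB : B.Nondegenerate) (v : H) (j : ι) : B v (B.dualBasis hB b j) = b.repr v j := by
  cases nonempty_fintype ι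
  conv_lhs => rw [← b.sum_repr v]
  simp only [map_sum, map_smul, LinearMap.sum_apply, LinearMap.smul_apply,
    LinearMap.BilinForm.apply_dualBasis_right hB hsymm]
  simp

variable [CharZero K]

theorem polar_hamiltonian_qVec_qVec (hsymm : B.IsSymm) {A : PowerSeries (Module.End K H)}
    (hA : IsInfinitesimalSymplectic B A) (p : (ℕ × ι) × (ℕ × ι)) :
    QuadraticMap.polar (hamiltonian B (-A)) (qVec b p.1) (qVec b p.2) =
      kernelMatrix B b (fun k l => coeff₂ k l (hamiltonianKernel A)) p := by
  rw [hA.neg.polar_hamiltonian hsymm, act_neg, Omega_neg_left, qVec, qVec, Omega_zMonomial_right,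
    zCoeff_act_zMonomial, if_pos (by omega), kernelMatrix, coeff₂_hamiltonianKernel,
    LinearMap.smul_apply, map_smul, LinearMap.smul_apply, smul_eq_mul,
    show ((p.1.1 : ℤ) - (-1 - p.2.1)).toNat = p.1.1 + p.2.1 + 1 by omega,
    show (-1 : ℤ) - p.2.1 = -((p.2.1 + 1 : ℕ) : ℤ) by push_cast; ring, zpow_neg, zpow_natCast,
    ← inv_pow, inv_neg, inv_one, pow_succ]
  ring

theorem polar_hamiltonian_qVec_pVec [Finite ι] [DecidableEq ι] (hsymm : B.IsSymm)
    (hB : B.Nondegenerate) {A : PowerSeries (Module.End K H)}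
    (hA : IsInfinitesimalSymplectic B A) (i j : ℕ × ι) :
    QuadraticMap.polar (hamiltonian B (-A)) (qVec b i) (pVec B hB b j) = actMatrix b A j i := by
  rw [hA.neg.polar_hamiltonian hsymm, act_neg, Omega_neg_left, pVec, Omega_zMonomial_right,
    sub_sub_cancel, map_smul, apply_dualBasis_eq_repr b hsymm, smul_eq_mul, ← mul_assoc,
    ← zpow_add₀ (by simp : (-1 : K) ≠ 0), show (j.1 : ℤ) + (-1 - j.1) = -1 by ring, zpow_neg_one,
    inv_neg, inv_one, neg_one_mul, neg_neg]
  rfl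

/-- `A` preserves the space of negative powers of `z`, which is isotropic. -/
theorem polar_hamiltonian_pVec_pVec [Finite ι] [DecidableEq ι] (hsymm : B.IsSymm)
    (hB : B.Nondegenerate) {A : PowerSeries (Module.End K H)}
    (hA : IsInfinitesimalSymplectic B A) (i j : ℕ × ι) :
    QuadraticMap.polar (hamiltonian B (-A)) (pVec B hB b i) (pVec B hB b j) = 0 := by
  rw [hA.neg.polar_hamiltonian hsymm, pVec, pVec, Omega_zMonomial_right, zCoeff_act_zMonomial,
    if_neg (by omega), map_zero, LinearMap.zero_apply, mul_zero]

end Hamiltonian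

/-! ### The quantized operator and its exponential -/

section Operator

variable {K H ι R : Type*} [Field K] [AddCommGroup H] [Module K H] [CommRing R] [Algebra K R]
  {B : LinearMap.BilinForm K H} (b : Module.Basis ι K H)

variable (B R) in
/-- The quadratic part `Q` of the operator `D + ħ⁻¹ Q`. -/
def potential (A : PowerSeries (Module.End K H)) : MvPowerSeries (ℕ × ι) R :=
  quadSeries R fun p =>
    (2 : K)⁻¹ * kernelMatrix B b (fun k l => coeff₂ k l (hamiltonianKernel A)) p

theorem coeffFinite_potential_mul (A : PowerSeries (Module.End K H))
    (f : MvPowerSeries (ℕ × ι) R) : CoeffFinite fun p : (ℕ × ι) × (ℕ × ι) =>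
      ((2 : K)⁻¹ * kernelMatrix B b (fun k l => coeff₂ k l (hamiltonianKernel A)) p) •
        (MvPowerSeries.X p.1 * MvPowerSeries.X p.2 * f) :=
  (coeffFinite_X_mul_X.mul fun _ => f).smul _

theorem quadSeries_mul_left (c : K) (m : (ℕ × ι) × (ℕ × ι) → K) :
    (quadSeries R fun p => c * m p) = c • quadSeries R m := by
  rw [quadSeries, quadSeries, ← coeffSum_smul (coeffFinite_X_mul_X.smul _)]
  simp only [mul_smul]

theorem fockSummable_expMulTerm (W : ℕ → ℕ → Module.End K H) (Ψ : Fock ι R) :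
    FockSummable (expMulTerm K (quadForm R B b W) Ψ) := by
  intro g d
  refine (Set.finite_Iic (Finsupp.weight varWeight d)).subset fun n hn => ?_
  by_contra h
  refine hn (((((vanishBelow_quadSeries (R := R) (kernelMatrix B b W)).pow n).mul
    (vanishBelow_zero _)).smul _) d ?_)
  rw [mul_one, add_zero]
  simpa using h

variable [Finite ι]

theorem coeffFinite_actMatrix_smul (A : PowerSeries (Module.End K H))
    (f : MvPowerSeries (ℕ × ι) R) : CoeffFinite fun p : (ℕ × ι) × (ℕ × ι) =>
      actMatrix b A p.2 p.1 • (MvPowerSeries.X p.1 * MvPowerSeries.pderiv R p.2 f) :=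
  coeffFinite_smul_X_mul (μ := fun m j => actMatrix b A j m) (finite_actMatrix b A)
    fun _ j => MvPowerSeries.pderiv R j f

variable [CharZero K] [DecidableEq ι] (hB : B.Nondegenerate) {A : PowerSeries (Module.End K H)}

theorem quadTerm_apply (hsymm : B.IsSymm) (hA : IsInfinitesimalSymplectic B A) (Ψ : Fock ι R)
    (p : (ℕ × ι) × (ℕ × ι)) (g : ℤ) :
    quadTerm B hB b (hamiltonian B (-A)) Ψ p g =
      ((2 : K)⁻¹ * kernelMatrix B b (fun k l => coeff₂ k l (hamiltonianKernel A)) p) •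
        (MvPowerSeries.X p.1 * MvPowerSeries.X p.2 * Ψ g) +
      actMatrix b A p.2 p.1 •
        (MvPowerSeries.X p.1 * MvPowerSeries.pderiv R p.2 (Ψ (g - 1))) := by
  rw [quadTerm, polar_hamiltonian_qVec_qVec b hsymm hA, polar_hamiltonian_qVec_pVec b hsymm hB hA,
    polar_hamiltonian_pVec_pVec b hsymm hB hA, mul_zero, zero_smul, add_zero, mul_assoc]
  rfl

theorem fockSummable_quadTerm (hsymm : B.IsSymm) (hA : IsInfinitesimalSymplectic B A)
    (Ψ : Fock ι R) : FockSummable (quadTerm B hB b (hamiltonian B (-A)) Ψ) := by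
  intro g
  simp only [quadTerm_apply b hB hsymm hA]
  exact (coeffFinite_potential_mul b A _).add (coeffFinite_actMatrix_smul b A _)

theorem hatOp_apply (hsymm : B.IsSymm) (hA : IsInfinitesimalSymplectic B A) (Ψ : Fock ι R)
    (g : ℤ) : hatOp B hB b (-A) Ψ g =
      linearField R b A (Ψ g) + potential R B b A * Ψ (g + 1) := by
  have h : hatOp B hB b (-A) Ψ g =
      coeffSum fun p => quadTerm B hB b (hamiltonian B (-A)) Ψ p (g + 1) := by
    rw [← sub_neg_eq_add]
    rfl
  rw [h]
  simp only [quadTerm_apply b hB hsymm hA, add_sub_cancel_right]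
  -- The `ħ` in `p̂` cancels the prefactor `ħ⁻¹` on the `qp` terms. Summing these over the `q` index
  -- first produces the components of the vector field.
  rw [coeffSum_add (coeffFinite_potential_mul b A _) (coeffFinite_actMatrix_smul b A _), add_comm,
    coeffSum_curry_swap (coeffFinite_actMatrix_smul b A _), linearField, vectorField_apply,
    potential, quadSeries, coeffSum_mul (coeffFinite_X_mul_X.smul _)]
  simp only [linSeries, coeffSum_mul (coeffFinite_X.smul _), smul_mul_assoc]

theorem fockSummable_expTerm (hsymm : B.IsSymm) (hA0 : PowerSeries.coeff 0 A = 0)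
    (hA : IsInfinitesimalSymplectic B A) (Ψ : Fock ι R) :
    FockSummable (expTerm K (hatOp B hB b (-A)) Ψ) := by
  intro g d
  refine (Set.finite_Iic (Finsupp.weight varWeight d)).subset fun n hn => ?_
  by_contra h
  exact hn (vanishBelow_iterate_operator (fun _ _ => vanishBelow_linearField b hA0)
    (vanishBelow_quadSeries _) (hatOp_apply b hB hsymm hA) Ψ n g d (by simpa using h))

variable [FiniteDimensional K H]

omit [DecidableEq ι] in
theorem iterate_linearField_potential (A : PowerSeries (Module.End K H)) (n : ℕ) :
    (linearField R b A)^[n] (potential R B b A) =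
      (2 : K)⁻¹ • quadSeries R (kernelMatrix B b fun k l =>
        coeff₂ k l ((twoSided K (adjSeries hB A) A ^ n) (hamiltonianKernel A))) := by
  induction n with
  | zero => rw [← quadSeries_mul_left]; rfl
  | succ n ih =>
    rw [Function.iterate_succ_apply', ih, Derivation.map_algebra_smul, linearField_quadSeries b hB,
      pow_succ', Module.End.mul_apply]

-- The coefficient of `t^(n+1)` in the integral is `Dⁿ Q / (n+1)!`, which is the source of the
-- factorials in `wCoeff`.
omit [DecidableEq ι] in
theorem evalOne_flowIntegral_potential (hA0 : PowerSeries.coeff 0 A = 0) :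
    evalOne varWeight (flowIntegral (linearField R b A) K (potential R B b A)) =
      (2 : K)⁻¹ • quadForm R B b (wCoeff hB A) := by
  ext d
  rw [coeff_evalOne_def, Finset.sum_range_succ']
  simp only [flowIntegral, PowerSeries.coeff_mk, if_true, map_zero, add_zero, Nat.succ_ne_zero,
    if_false, Nat.add_sub_cancel, iterate_linearField_potential b hB, coeff_algebra_smul]
  simp only [smul_comm _ (2 : K)⁻¹, ← Finset.smul_sum]
  congr 1
  refine (coeff_coeffSum_smul_eq_sum coeffFinite_X_mul_X fun p hp => ?_).symm
  have hp' := weight_of_coeff_X_mul_X_ne_zero hp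
  change kernelMatrix B b (wCoeff hB A) p = _
  simp only [kernelMatrix]
  rw [wCoeff_eq_sum hB hA0 hp', LinearMap.sum_apply, map_sum, LinearMap.sum_apply]
  simp

theorem quantizedExp_neg_eq (hsymm : B.IsSymm) (hA0 : PowerSeries.coeff 0 A = 0)
    (hA : IsInfinitesimalSymplectic B A) (Ψ : Fock ι R) :
    quantizedExp B hB b (-A) Ψ =
      expMul K (quadForm R B b (wCoeff hB A)) (pullback b (expSeries A) Ψ) := by
  ext1 g
  have hD : ∀ n f, VanishBelow varWeight n f →
      VanishBelow varWeight (n + 1) (linearField R b A f) := fun _ _ =>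
    vanishBelow_linearField b hA0
  have h := coeffSum_exp_operator (K := K) hD (vanishBelow_quadSeries _)
    (hatOp_apply b hB hsymm hA) Ψ g
  refine Eq.trans h (congrArg coeffSum (funext fun m => ?_))
  -- The powers of two come from `P(1)` being half of the quadratic form of `W`.
  have h2 : (m ! : K)⁻¹ * (2 : K)⁻¹ ^ m = (2 ^ m * (m ! : K))⁻¹ := by
    rw [mul_inv, inv_pow, mul_comm]
  rw [evalOne_expFlow_eq_subst (wt := varWeight) finite_weight_lt hD
    (hasSubst_truncAct b (expSeries A))
    (evalOne_expFlow_X b hA0)]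
  change _ • (evalOne varWeight (flowIntegral (linearField R b A) K (potential R B b A)) ^ m *
    _) = _
  rw [evalOne_flowIntegral_potential b hB hA0, smul_pow, smul_mul_assoc, smul_smul, h2,
    ← sub_neg_eq_add]
  rfl

end Operator

end GiventalQuantization

end

theorem mainTheorem2 {K H ι R : Type*} [Field K] [CharZero K]
    [AddCommGroup H] [Module K H] [FiniteDimensional K H]
    [Fintype ι] [DecidableEq ι] [CommRing R] [Algebra K R]
    (B : LinearMap.BilinForm K H) (hsymm : B.IsSymm) (hB : B.Nondegenerate)
    (b : Module.Basis ι K H)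
    (A S : PowerSeries (Module.End K H))
    (hA0 : PowerSeries.constantCoeff A = 0)
    (hA : GiventalQuantization.IsInfinitesimalSymplectic B A)
    (hS : S = GiventalQuantization.expSeries A) :
    -- `exp(-A)` is the inverse of `S`, so that `U_{S⁻¹}` is `exp` of the quantization of `-A`
    (S * GiventalQuantization.expSeries (-A) = 1 ∧
      GiventalQuantization.expSeries (-A) * S = 1) ∧
    -- the coefficients `W k l` are well defined
    (∃! W : ℕ → ℕ → Module.End K H, GiventalQuantization.IsWCoeff B hB S W) ∧
    -- the formal operations are well defined
    MvPowerSeries.HasSubst (GiventalQuantization.truncAct R b S) ∧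
    (∀ Ψ : GiventalQuantization.Fock ι R,
      GiventalQuantization.FockSummable (GiventalQuantization.quadTerm B hB b
        (GiventalQuantization.hamiltonian B (-A)) Ψ) ∧
      GiventalQuantization.FockSummable (GiventalQuantization.expTerm K
        (GiventalQuantization.hatOp B hB b (-A)) Ψ)) ∧
    -- the formula for `U_{S⁻¹}`
    (∀ W : ℕ → ℕ → Module.End K H, GiventalQuantization.IsWCoeff B hB S W →
      ∀ Ψ : GiventalQuantization.Fock ι R,
        GiventalQuantization.FockSummable (GiventalQuantization.expMulTerm K
          (GiventalQuantization.quadForm R B b W) (GiventalQuantization.pullback b S Ψ)) ∧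
        GiventalQuantization.quantizedExp B hB b (-A) Ψ =
          GiventalQuantization.expMul K (GiventalQuantization.quadForm R B b W)
            (GiventalQuantization.pullback b S Ψ)) := by
  subst hS
  have h0 : PowerSeries.coeff 0 A = 0 := by
    rw [PowerSeries.coeff_zero_eq_constantCoeff_apply, hA0]
  have hW := GiventalQuantization.isWCoeff_wCoeff hB hsymm h0 hA
  refine ⟨⟨GiventalQuantization.expSeries_mul_neg h0, GiventalQuantization.expSeries_neg_mul h0⟩,
    ⟨_, hW, fun W' hW' => GiventalQuantization.IsWCoeff.unique hB hW' hW⟩,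
    GiventalQuantization.hasSubst_truncAct b _, fun Ψ =>
    ⟨GiventalQuantization.fockSummable_quadTerm b hB hsymm hA Ψ,
      GiventalQuantization.fockSummable_expTerm b hB hsymm h0 hA Ψ⟩, fun W hW' Ψ =>
    ⟨GiventalQuantization.fockSummable_expMulTerm b W _, ?_⟩⟩
  -- Uniqueness replaces an arbitrary solution `W` by the explicit integral formula.
  rw [GiventalQuantization.IsWCoeff.unique hB hW' hW]
  exact GiventalQuantization.quantizedExp_neg_eq b hB hsymm h0 hA Ψ
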